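/- **Model.** There are $n$ asynchronous sequential processes $p_1,\dots,p_n$, of which at most $t_b\ge 0$ are Byzantine (arbitrary behaviour); the others are correct, and $c$ denotes the number of correct processes in the execution considered, so $n-t_b\le c\le n$. Processes communicate over a fully connected, authenticated, asynchronous point-to-point network that neither corrupts, duplicates nor creates messages. Correct processes send messages only by the operation $\mathsf{ur\_broadcast}(msg)$, which sends a copy of $msg$ to every process; at each such invocation by a correct process a message adversary may suppress up to $t_m\ge 0$ of the copies intended to correct processes. The remaining copies sent to correct processes are eventually received. Byzantine processes may send arbitrary messages to arbitrary processes. No correct process uses the same sequence number for two of its broadcasts. **The object $\mathsf{SigFreeKLCast}(q_d,q_f,single)$** (code of a process). Operation $k\ell\mathsf{\_cast}(m,id)$: if no $\textsc{msg}(-,id)$ was already ur-broadcast, then ur-broadcast $\textsc{msg}(m,id)$. When $\textsc{msg}(m,id)$ is received: (forwarding) if $\textsc{msg}(m,id)$ has been received from at least $q_f$ processes, and either $single$ is false and $\textsc{msg}(m,id)$ was not already ur-broadcast, or no $\textsc{msg}(-,id)$ was already ur-broadcast, then ur-broadcast $\textsc{msg}(m,id)$; then (delivery) if $\textsc{msg}(m,id)$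 has been received from at least $q_d$ processes and no $(-,id)$ was already $k\ell$-delivered, then $k\ell$-deliver $(m,id)$. **The algorithm (revisited Bracha).** It uses two objects, $obj_E=\mathsf{SigFreeKLCast}(q_d=\lfloor\frac{n+t_b}{2}\rfloor+1,\ q_f=t_b+1,\ single=\mathtt{true})$ and $obj_R=\mathsf{SigFreeKLCast}(q_d=2t_b+t_m+1,\ q_f=t_b+1,\ single=\mathtt{true})$. Operation $\mathsf{mbrb\_broadcast}(m,sn)$: ur-broadcast $\textsc{init}(m,sn)$. When $\textsc{init}(m,sn)$ is received from $p_j$: $obj_E.k\ell\mathsf{\_cast}(\textsc{echo}(m),(sn,j))$. When $(\textsc{echo}(m),(sn,j))$ is $k\ell$-delivered by $obj_E$: $obj_R.k\ell\mathsf{\_cast}(\textsc{ready}(m),(sn,j))$. When $(\textsc{ready}(m),(sn,j))$ is $k\ell$-delivered by $obj_R$: $\mathsf{mbrb\_deliver}(m,sn,j)$. **Theorem.** Assume $n>3t_b+2t_m+2\sqrt{t_bt_m}$, and let $$\ell_{\mathrm{MBRB}}=\left\lceil c\left(1-\frac{t_m}{c-2t_b-t_m}\right)\right\rceil .$$ Then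 this algorithm implements MBRB with guarantee $\ell_{\mathrm{MBRB}}$, that is, in every execution: * (Validity) if a correct process mbrb-delivers $(m,sn,j)$ and $p_j$ is correct, then $p_j$ has previously mbrb-broadcast $(m,sn)$; * (No-duplication) a correct process mbrb-delivers at most one message from a given process $p_j$ with a given sequence number $sn$ (and at most once); * (No-duplicity) no two different correct processes mbrb-deliver different messages from the same process $p_j$ with the same sequence number; * (Local delivery) if a correct process $p_i$ mbrb-broadcasts $(m,sn)$, then at least one correct process eventually mbrb-delivers $(m,sn,i)$; * (Global delivery) if a correct process mbrb-delivers $(m,sn,j)$, then at least $\ell_{\mathrm{MBRB}}$ correct processes mbrb-deliver $(m,sn,j)$. -/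

import Mathlib

/-! Signature-free `kℓ`-cast objects, the asynchronous Byzantine message-passing model with a
message adversary, the `kℓ`-cast-based version of Bracha's broadcast algorithm, and the
specification of Message-adversarial Byzantine Reliable Broadcast (MBRB).

The `n` processes are the elements of `Fin n`. -/

namespace MBRB

/-! ### The signature-free `kℓ`-cast object -/

/-- The input parameters of a signature-free `kℓ`-cast object: the delivery quorum `qd`, the
forwarding quorum `qf` and the Boolean `single`. -/
structure KLParams where
  qd : ℕ
  qf : ℕ
  single : Bool

/-- The local state, at one process, of a signature-free `kℓ`-cast object for app-messages in `A`
with identities in `I`. -/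
structure KLState (n : ℕ) (A I : Type*) where
  /-- the pairs `(m, id)` such that this process already ur-broadcast `msg(m, id)` -/
  sent : Set (A × I)
  /-- the triples `(j, m, id)` such that this process received `msg(m, id)` from `j` -/
  rcvd : Set (Fin n × A × I)
  /-- the pairs `(m, id)` that this process already `kℓ`-delivered -/
  dlvd : Set (A × I)

namespace KLState

variable {n : ℕ} {A I : Type*}

/-- The initial state. -/
def empty (n : ℕ) (A I : Type*) : KLState n A I := ⟨∅, ∅, ∅⟩

/-- The number of distinct processes from which `msg(m, id)` has been received. -/
noncomputable def count (s : KLState n A I) (m : A) (id : I) : ℕ :=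
  {j : Fin n | (j, m, id) ∈ s.rcvd}.ncard

open Classical in
/-- Operation `kl_cast(m, id)`. Returns the new state and the pair that is ur-broadcast, if any. -/
noncomputable def klCast (s : KLState n A I) (m : A) (id : I) :
    KLState n A I × Option (A × I) :=
  if ∀ m' : A, (m', id) ∉ s.sent then
    ({ s with sent := insert (m, id) s.sent }, some (m, id))
  else (s, none)

open Classical in
/-- The forwarding step. Returns the new state and the pair that is ur-broadcast, if any. -/
noncomputable def forwardStep (P : KLParams) (s : KLState n A I) (m : A) (id : I) :
    KLState n A I × Option (A × I) :=
  if P.qf ≤ s.count m id ∧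
      ((P.single = false ∧ (m, id) ∉ s.sent) ∨ ∀ m' : A, (m', id) ∉ s.sent) then
    ({ s with sent := insert (m, id) s.sent }, some (m, id))
  else (s, none)

open Classical in
/-- The delivery step. Returns the new state and the pair that is `kℓ`-delivered, if any. -/
noncomputable def deliverStep (P : KLParams) (s : KLState n A I) (m : A) (id : I) :
    KLState n A I × Option (A × I) :=
  if P.qd ≤ s.count m id ∧ ∀ m' : A, (m', id) ∉ s.dlvd then
    ({ s with dlvd := insert (m, id) s.dlvd }, some (m, id))
  else (s, none)

/-- The code executed when `msg(m, id)` is received from `j`. Returns the new state, the pair that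
is ur-broadcast (if any) and the pair that is `kℓ`-delivered (if any). -/
noncomputable def receive (P : KLParams) (s : KLState n A I) (j : Fin n) (m : A) (id : I) :
    KLState n A I × Option (A × I) × Option (A × I) :=
  let s₁ : KLState n A I := { s with rcvd := insert (j, m, id) s.rcvd }
  let r₂ := s₁.forwardStep P m id
  let r₃ := r₂.1.deliverStep P m id
  (r₃.1, r₂.2, r₃.2)

end KLState

/-! ### The revisited Bracha algorithm -/

/-- Identity of an app-message: sequence number and identity of the sender. -/
abbrev AppId (n : ℕ) : Type := ℕ × Fin n

/-- The imp-messages of the algorithm. -/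
inductive ImpMsg (n : ℕ) (M : Type*) where
  | init (m : M) (sn : ℕ)
  | echo (m : M) (id : AppId n)
  | ready (m : M) (id : AppId n)

/-- The parameters of the object used for the `echo` phase. -/
def echoParams (n tb : ℕ) : KLParams := ⟨(n + tb) / 2 + 1, tb + 1, true⟩

/-- The parameters of the object used for the `ready` phase. -/
def readyParams (tb tm : ℕ) : KLParams := ⟨2 * tb + tm + 1, tb + 1, true⟩

/-- The local state of a correct process. -/
structure LocalState (n : ℕ) (M : Type*) where
  echoObj : KLState n M (AppId n)
  readyObj : KLState n M (AppId n)
  /-- what the `echo` object has `kℓ`-delivered, and the algorithm has not handled yet -/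
  echoUp : Multiset (M × AppId n)
  /-- what the `ready` object has `kℓ`-delivered, and the algorithm has not handled yet -/
  readyUp : Multiset (M × AppId n)

namespace LocalState

variable {n : ℕ} {M : Type*}

/-- The initial local state. -/
def empty (n : ℕ) (M : Type*) : LocalState n M :=
  ⟨KLState.empty n M (AppId n), KLState.empty n M (AppId n), 0, 0⟩

/-- The code executed when the imp-message `msg` is received from `q`: an `init` imp-message leads
to a `kℓ`-cast on the `echo` object; the other imp-messages are handled by the `echo` object and
by the `ready` object. Returns the new state and the imp-message that is ur-broadcast, if any. -/
noncomputable def receive (tb tm : ℕ) (s : LocalState n M) (q : Fin n) (msg : ImpMsg n M) :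
    LocalState n M × Option (ImpMsg n M) :=
  match msg with
  | .init m sn =>
    let r := s.echoObj.klCast m (sn, q)
    ({ s with echoObj := r.1 }, r.2.map fun x => .echo x.1 x.2)
  | .echo m id =>
    let r := s.echoObj.receive (echoParams n tb) q m id
    ({ s with echoObj := r.1, echoUp := r.2.2.elim s.echoUp fun x => x ::ₘ s.echoUp },
      r.2.1.map fun x => .echo x.1 x.2)
  | .ready m id =>
    let r := s.readyObj.receive (readyParams tb tm) q m id
    ({ s with readyObj := r.1, readyUp := r.2.2.elim s.readyUp fun x => x ::ₘ s.readyUp },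
      r.2.1.map fun x => .ready x.1 x.2)

/-- The `kℓ`-cast of `(m, id)` on the `ready` object. -/
noncomputable def castReady (s : LocalState n M) (m : M) (id : AppId n) :
    LocalState n M × Option (ImpMsg n M) :=
  let r := s.readyObj.klCast m id
  ({ s with readyObj := r.1 }, r.2.map fun x => .ready x.1 x.2)

end LocalState

/-! ### Executions -/

/-- A point-to-point imp-message in transit: its source, its destination, its content. -/
abbrev Packet (n : ℕ) (M : Type*) : Type _ := Fin n × Fin n × ImpMsg n M

/-- A global configuration: the local states (those of Byzantine processes are meaningless and
never used) and the point-to-point imp-messages in transit. -/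
structure Config (n : ℕ) (M : Type*) where
  loc : Fin n → LocalState n M
  net : Multiset (Packet n M)

/-- The initial configuration. -/
def Config.initial (n : ℕ) (M : Type*) : Config n M := ⟨fun _ => LocalState.empty n M, 0⟩

/-- The events of an execution. -/
inductive Event (n : ℕ) (M : Type*) where
  /-- nothing happens -/
  | idle
  /-- the Byzantine process `q` sends `msg` to `p` -/
  | byzSend (q p : Fin n) (msg : ImpMsg n M)
  /-- the correct process `p` invokes `mbrb_broadcast(m, sn)` -/
  | broadcast (p : Fin n) (m : M) (sn : ℕ)
  /-- the correct process `p` receives `msg` from `q` -/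
  | receive (p q : Fin n) (msg : ImpMsg n M)
  /-- the correct process `p` handles the `kℓ`-delivery of `(m, id)` by the `echo` object -/
  | echoDelivered (p : Fin n) (m : M) (id : AppId n)
  /-- the correct process `p` handles the `kℓ`-delivery of `(m, (sn, j))` by the `ready` object:
  it mbrb-delivers `(m, sn, j)` -/
  | readyDelivered (p : Fin n) (m : M) (id : AppId n)

section

variable {n : ℕ} {M : Type*}

/-- `ur_broadcast(msg)` by the correct process `p`, where `C` is the set of correct processes and
the content of the network turns from `net` to `net'`: a copy is sent to every process, but the
message adversary suppresses the copies intended to a set `D` of at most `tm` correct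
processes. -/
def UrBroadcast (tm : ℕ) (C : Finset (Fin n)) (p : Fin n) (msg : ImpMsg n M)
    (net net' : Multiset (Packet n M)) : Prop :=
  ∃ D : Finset (Fin n), D ⊆ C ∧ D.card ≤ tm ∧
    net' = net + (Finset.univ \ D).val.map fun d => (p, d, msg)

/-- The correct process `p` moves to the local state `r.1` and ur-broadcasts `r.2`, if any; `net`
is the content of the network before this possible ur-broadcast. -/
def LocalMove (tm : ℕ) (C : Finset (Fin n)) (c : Config n M) (net : Multiset (Packet n M))
    (p : Fin n) (r : LocalState n M × Option (ImpMsg n M)) (c' : Config n M) : Prop :=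
  c'.loc = Function.update c.loc p r.1 ∧
    match r.2 with
    | none => c'.net = net
    | some msg => UrBroadcast tm C p msg net c'.net

/-- `Step tb tm C c e c'`: the event `e` can lead from the configuration `c` to the configuration
`c'` when `C` is the set of correct processes. -/
def Step (tb tm : ℕ) (C : Finset (Fin n)) (c : Config n M) (e : Event n M)
    (c' : Config n M) : Prop :=
  match e with
  | .idle => c' = c
  | .byzSend q p msg => q ∉ C ∧ c' = { c with net := (q, p, msg) ::ₘ c.net }
  | .broadcast p m sn => p ∈ C ∧ LocalMove tm C c c.net p (c.loc p, some (.init m sn)) c'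
  | .receive p q msg => p ∈ C ∧ ∃ net, c.net = (q, p, msg) ::ₘ net ∧
      LocalMove tm C c net p ((c.loc p).receive tb tm q msg) c'
  | .echoDelivered p m id => p ∈ C ∧ ∃ up, (c.loc p).echoUp = (m, id) ::ₘ up ∧
      LocalMove tm C c c.net p
        (LocalState.castReady { c.loc p with echoUp := up } m id) c'
  | .readyDelivered p m id => p ∈ C ∧ ∃ up, (c.loc p).readyUp = (m, id) ::ₘ up ∧
      LocalMove tm C c c.net p ({ c.loc p with readyUp := up }, none) c'

/-- `cfg` and `ev` form an execution of the algorithm in which `C` is the set of correct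
processes: `ev t` leads from `cfg t` to `cfg (t + 1)`. Every copy of an imp-message ur-broadcast by
a correct process that the message adversary does not suppress is eventually received if its
recipient is correct, and correct processes eventually handle their `kℓ`-deliveries. -/
structure IsExecution (tb tm : ℕ) (C : Finset (Fin n)) (cfg : ℕ → Config n M)
    (ev : ℕ → Event n M) : Prop where
  start : cfg 0 = Config.initial n M
  step : ∀ t, Step tb tm C (cfg t) (ev t) (cfg (t + 1))
  received : ∀ t, ∀ p ∈ C, ∀ q ∈ C, ∀ msg, (q, p, msg) ∈ (cfg t).net →
    ∃ t' ≥ t, ev t' = .receive p q msg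
  echoHandled : ∀ t, ∀ p ∈ C, ∀ m id, (m, id) ∈ ((cfg t).loc p).echoUp →
    ∃ t' ≥ t, ev t' = .echoDelivered p m id
  readyHandled : ∀ t, ∀ p ∈ C, ∀ m id, (m, id) ∈ ((cfg t).loc p).readyUp →
    ∃ t' ≥ t, ev t' = .readyDelivered p m id

/-- `p` mbrb-broadcasts `(m, sn)` at time `t`. -/
def Broadcasts (ev : ℕ → Event n M) (t : ℕ) (p : Fin n) (m : M) (sn : ℕ) : Prop :=
  ev t = .broadcast p m sn

/-- `p` mbrb-delivers `(m, sn, j)` at time `t`. -/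
def Delivers (ev : ℕ → Event n M) (t : ℕ) (p : Fin n) (m : M) (sn : ℕ) (j : Fin n) : Prop :=
  ev t = .readyDelivered p m (sn, j)

/-- No correct process uses a sequence number twice. -/
def DistinctSeqNumbers (C : Finset (Fin n))
    (bcast : ℕ → Fin n → M → ℕ → Prop) : Prop :=
  ∀ p ∈ C, ∀ t t' m m' sn, bcast t p m sn → bcast t' p m' sn → t = t'

/-! ### The MBRB specification -/

/-- The properties of MBRB with global delivery guarantee `l`, for a history given by the relations
`bcast t p m sn` (`p` mbrb-broadcasts `(m, sn)` at time `t`) and `dlv t p m sn j`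
(`p` mbrb-delivers `(m, sn, j)` at time `t`), where `C` is the set of correct processes. -/
structure IsMBRB (C : Finset (Fin n)) (bcast : ℕ → Fin n → M → ℕ → Prop)
    (dlv : ℕ → Fin n → M → ℕ → Fin n → Prop) (l : ℤ) : Prop where
  validity : ∀ i ∈ C, ∀ j ∈ C, ∀ t m sn, dlv t i m sn j → ∃ t' < t, bcast t' j m sn
  noDuplication : ∀ i ∈ C, ∀ j t t' m m' sn, dlv t i m sn j → dlv t' i m' sn j →
    t = t' ∧ m = m'
  noDuplicity : ∀ i ∈ C, ∀ i' ∈ C, ∀ j t t' m m' sn, dlv t i m sn j → dlv t' i' m' sn j →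
    m = m'
  localDelivery : ∀ i ∈ C, ∀ t m sn, bcast t i m sn → ∃ j ∈ C, ∃ t' > t, dlv t' j m sn i
  globalDelivery : ∀ i ∈ C, ∀ j t m sn, dlv t i m sn j →
    l ≤ ({p : Fin n | p ∈ C ∧ ∃ t', dlv t' p m sn j}.ncard : ℤ)

end

end MBRB

/-! Safety rests on quorum intersection and on the forwarding threshold. Since `qf = tb + 1` exceeds
the number of Byzantine processes, no chain of forwards starts from Byzantine messages alone:
whatever a correct process ur-broadcasts through an object was `kℓ`-cast earlier by a correct
process (`exists_cast_of_sent`). Going back through both objects gives validity. Two echo delivery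
quorums share more than `tb` processes, hence a correct one, which sends only one message per
identity (`dlvd_agree`). So all correct `ready` messages of an identity agree, which gives
no-duplicity.

Liveness is a double count. Fix an identity for which correct processes send only `m`, and let `c`,
`k`, `l` be the numbers of correct processes, of those that send `m`, and of those that deliver it.
Every sender reaches at least `c - tm` correct processes. On the receiving side, a deliverer hears
at most `k` correct senders, a sender that never delivers at most `qd - 1`, and a non-sender at most
`tb`. Hence (`card_mul_le_deliverers`) `k (c - tm) ≤ l k + (k - l) (qd - 1) + (c - k) tb`. The bound
on `l` that follows is weakest at `k = c`, provided that `k > qd - 1` and a quadratic condition on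
the quorum holds (`mul_le_mul_of_quorum`). For the ready object this worst case is exactly the
claimed guarantee.

As `n ≤ c + tb`, the hypothesis yields `c > 2 tb + 2 tm + 2 √(tb tm)`. For global delivery, one
delivery forces `k ≥ tb + tm + 1`, and a convexity argument lifts this to `k > 2 tb + tm`
(`ready_lt_card`). For local delivery, at least `c - tm` correct processes send the echo, so many
deliver it and send `ready`, too many for the count to allow no ready delivery (`ready_trigger`). -/

namespace MBRB

/-! ### Local behaviour of one `kℓ`-cast object and its invariant. -/

namespace KLState

variable {n : ℕ} {A I : Type*} {P : KLParams} {s : KLState n A I} {m : A} {id : I} {j : Fin n}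
  {x : A × I}

@[simp] theorem klCast_rcvd : (s.klCast m id).1.rcvd = s.rcvd := by
  unfold klCast; split_ifs <;> rfl

@[simp] theorem klCast_dlvd : (s.klCast m id).1.dlvd = s.dlvd := by
  unfold klCast; split_ifs <;> rfl

theorem mem_klCast_sent :
    x ∈ (s.klCast m id).1.sent ↔ x ∈ s.sent ∨ (s.klCast m id).2 = some x := by
  unfold klCast; split_ifs
  · simp [eq_comm, or_comm]
  · simp

theorem klCast_eq_some (h : (s.klCast m id).2 = some x) :
    x = (m, id) ∧ ∀ m', (m', id) ∉ s.sent := by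
  unfold klCast at h; split_ifs at h with h'; simp_all

theorem exists_mem_klCast_sent : ∃ m', (m', id) ∈ (s.klCast m id).1.sent := by
  by_cases h : ∀ m', (m', id) ∉ s.sent
  · exact ⟨m, by simp [klCast, h]⟩
  · push Not at h
    obtain ⟨m', h⟩ := h
    exact ⟨m', mem_klCast_sent.2 (Or.inl h)⟩

@[simp] theorem forwardStep_rcvd : (s.forwardStep P m id).1.rcvd = s.rcvd := by
  unfold forwardStep; split_ifs <;> rfl

@[simp] theorem forwardStep_dlvd : (s.forwardStep P m id).1.dlvd = s.dlvd := by
  unfold forwardStep; split_ifs <;> rfl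

theorem mem_forwardStep_sent : x ∈ (s.forwardStep P m id).1.sent ↔
    x ∈ s.sent ∨ (s.forwardStep P m id).2 = some x := by
  unfold forwardStep; split_ifs
  · simp [eq_comm, or_comm]
  · simp

@[simp] theorem deliverStep_rcvd : (s.deliverStep P m id).1.rcvd = s.rcvd := by
  unfold deliverStep; split_ifs <;> rfl

@[simp] theorem deliverStep_sent : (s.deliverStep P m id).1.sent = s.sent := by
  unfold deliverStep; split_ifs <;> rfl

theorem mem_deliverStep_dlvd : x ∈ (s.deliverStep P m id).1.dlvd ↔
    x ∈ s.dlvd ∨ (s.deliverStep P m id).2 = some x := by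
  unfold deliverStep; split_ifs
  · simp [eq_comm, or_comm]
  · simp

@[simp] theorem receive_rcvd : (s.receive P j m id).1.rcvd = insert (j, m, id) s.rcvd := by
  simp [receive]

theorem count_eq_of_rcvd_eq {s' : KLState n A I} (h : s'.rcvd = s.rcvd) :
    s'.count m id = s.count m id := by
  simp [count, h]

theorem count_mono {s' : KLState n A I} (h : s.rcvd ⊆ s'.rcvd) : s.count m id ≤ s'.count m id :=
  Set.ncard_le_ncard (fun _ hj => h hj) (Set.toFinite _)

theorem mem_receive_sent : x ∈ (s.receive P j m id).1.sent ↔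
    x ∈ s.sent ∨ (s.receive P j m id).2.1 = some x := by
  simp [receive, mem_forwardStep_sent]

theorem mem_receive_dlvd : x ∈ (s.receive P j m id).1.dlvd ↔
    x ∈ s.dlvd ∨ (s.receive P j m id).2.2 = some x := by
  simp [receive, mem_deliverStep_dlvd]

/-- The guard is tested in an intermediate state, but forwarding and delivery leave `rcvd`
unchanged, so the count may be read in the final state. With `single` true, only the disjunct asking
for a fresh identity remains. -/
theorem receive_forward_eq_some (hP : P.single = true)
    (h : (s.receive P j m id).2.1 = some x) :
    x = (m, id) ∧ P.qf ≤ (s.receive P j m id).1.count m id ∧ ∀ m', (m', id) ∉ s.sent := by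
  have hc : (s.receive P j m id).1.count m id =
      ({ s with rcvd := insert (j, m, id) s.rcvd } : KLState n A I).count m id :=
    count_eq_of_rcvd_eq receive_rcvd
  rw [hc]
  simp only [receive, forwardStep] at h
  split_ifs at h with h'; simp_all

theorem receive_deliver_eq_some (h : (s.receive P j m id).2.2 = some x) :
    x = (m, id) ∧ P.qd ≤ (s.receive P j m id).1.count m id ∧ ∀ m', (m', id) ∉ s.dlvd := by
  have hc : (s.receive P j m id).1.count m id =
      (({ s with rcvd := insert (j, m, id) s.rcvd } : KLState n A I).forwardStep P m id).1.count
        m id :=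
    count_eq_of_rcvd_eq (by simp)
  rw [hc]
  simp only [receive, deliverStep] at h
  split_ifs at h with h'; simp_all

theorem exists_mem_receive_sent (h : P.qf ≤ (s.receive P j m id).1.count m id) :
    ∃ m', (m', id) ∈ (s.receive P j m id).1.sent := by
  by_contra! hs
  have hc : (s.receive P j m id).1.count m id =
      ({ s with rcvd := insert (j, m, id) s.rcvd } : KLState n A I).count m id :=
    count_eq_of_rcvd_eq receive_rcvd
  rw [hc] at h
  have h1 : ∀ m', (m', id) ∉ s.sent := fun m' hm => hs m' (mem_receive_sent.2 (Or.inl hm))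
  exact hs m (mem_receive_sent.2 (Or.inr (by simp [receive, forwardStep, h, h1])))

theorem exists_mem_receive_dlvd (h : P.qd ≤ (s.receive P j m id).1.count m id) :
    ∃ m', (m', id) ∈ (s.receive P j m id).1.dlvd := by
  by_contra! hs
  have hc : (s.receive P j m id).1.count m id =
      (({ s with rcvd := insert (j, m, id) s.rcvd } : KLState n A I).forwardStep P m id).1.count
        m id :=
    count_eq_of_rcvd_eq (by simp)
  rw [hc] at h
  have h1 : ∀ m', (m', id) ∉ s.dlvd := fun m' hm => hs m' (mem_receive_dlvd.2 (Or.inl hm))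
  refine hs m (mem_receive_dlvd.2 (Or.inr ?_))
  simp [receive, deliverStep, h, h1]

/-- The invariant of the states reachable by an object whose parameter `single` is true. -/
structure Inv (P : KLParams) (s : KLState n A I) : Prop where
  sent_unique : ∀ m m' id, (m, id) ∈ s.sent → (m', id) ∈ s.sent → m = m'
  dlvd_unique : ∀ m m' id, (m, id) ∈ s.dlvd → (m', id) ∈ s.dlvd → m = m'
  le_count : ∀ m id, (m, id) ∈ s.dlvd → P.qd ≤ s.count m id
  exists_sent : ∀ m id, P.qf ≤ s.count m id → ∃ m', (m', id) ∈ s.sent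
  exists_dlvd : ∀ m id, P.qd ≤ s.count m id → ∃ m', (m', id) ∈ s.dlvd

theorem inv_empty (hf : 0 < P.qf) (hd : 0 < P.qd) : Inv P (empty n A I) where
  sent_unique := by simp [empty]
  dlvd_unique := by simp [empty]
  le_count := by simp [empty]
  exists_sent m id h := by simp [empty, count] at h; omega
  exists_dlvd m id h := by simp [empty, count] at h; omega

theorem Inv.klCast (hs : Inv P s) : Inv P (s.klCast m id).1 where
  sent_unique a a' i h h' := by
    rw [mem_klCast_sent] at h h'
    rcases h with h | h <;> rcases h' with h' | h'
    · exact hs.sent_unique _ _ _ h h'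
    · obtain ⟨e, h0⟩ := klCast_eq_some h'
      simp only [Prod.mk.injEq] at e
      exact absurd (e.2 ▸ h) (h0 a)
    · obtain ⟨e, h0⟩ := klCast_eq_some h
      simp only [Prod.mk.injEq] at e
      exact absurd (e.2 ▸ h') (h0 a')
    · simpa using (h.symm.trans h')
  dlvd_unique := by simpa using hs.dlvd_unique
  le_count a i h := by
    rw [count_eq_of_rcvd_eq klCast_rcvd]
    exact hs.le_count _ _ (by simpa using h)
  exists_sent a i h := by
    rw [count_eq_of_rcvd_eq klCast_rcvd] at h
    obtain ⟨m', h⟩ := hs.exists_sent _ _ h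
    exact ⟨m', mem_klCast_sent.2 (Or.inl h)⟩
  exists_dlvd a i h := by
    rw [count_eq_of_rcvd_eq klCast_rcvd] at h
    simpa using hs.exists_dlvd _ _ h

/-- A reception changes a single counter, so the threshold clauses of `Inv` need a new check only
for the pair just received, which is the pair whose guards are then evaluated. -/
theorem count_receive_of_ne {a : A} {i : I} (h : (a, i) ≠ (m, id)) :
    (s.receive P j m id).1.count a i = s.count a i := by
  simp only [count, receive_rcvd]
  congr 1
  ext q
  simp only [Set.mem_ofPred_eq, Set.mem_insert_iff, Prod.mk.injEq]
  simp only [ne_eq, Prod.mk.injEq] at h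
  tauto

theorem Inv.receive (hP : P.single = true) (hs : Inv P s) : Inv P (s.receive P j m id).1 where
  sent_unique a a' i h h' := by
    rw [mem_receive_sent] at h h'
    rcases h with h | h <;> rcases h' with h' | h'
    · exact hs.sent_unique _ _ _ h h'
    · obtain ⟨e, -, h0⟩ := receive_forward_eq_some hP h'
      simp only [Prod.mk.injEq] at e
      exact absurd (e.2 ▸ h) (h0 a)
    · obtain ⟨e, -, h0⟩ := receive_forward_eq_some hP h
      simp only [Prod.mk.injEq] at e
      exact absurd (e.2 ▸ h') (h0 a')
    · simpa using (h.symm.trans h')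
  dlvd_unique a a' i h h' := by
    rw [mem_receive_dlvd] at h h'
    rcases h with h | h <;> rcases h' with h' | h'
    · exact hs.dlvd_unique _ _ _ h h'
    · obtain ⟨e, -, h0⟩ := receive_deliver_eq_some h'
      simp only [Prod.mk.injEq] at e
      exact absurd (e.2 ▸ h) (h0 a)
    · obtain ⟨e, -, h0⟩ := receive_deliver_eq_some h
      simp only [Prod.mk.injEq] at e
      exact absurd (e.2 ▸ h') (h0 a')
    · simpa using (h.symm.trans h')
  le_count a i h := by
    rw [mem_receive_dlvd] at h
    rcases h with h | h
    · exact (hs.le_count _ _ h).trans (count_mono (by simp))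
    · obtain ⟨e, h0, -⟩ := receive_deliver_eq_some h
      simp only [Prod.mk.injEq] at e
      rw [e.1, e.2]
      exact h0
  exists_sent a i h := by
    by_cases e : (a, i) = (m, id)
    · simp only [Prod.mk.injEq] at e
      rw [e.1, e.2] at h
      rw [e.2]
      exact exists_mem_receive_sent h
    · rw [count_receive_of_ne e] at h
      obtain ⟨m', h⟩ := hs.exists_sent _ _ h
      exact ⟨m', mem_receive_sent.2 (Or.inl h)⟩
  exists_dlvd a i h := by
    by_cases e : (a, i) = (m, id)
    · simp only [Prod.mk.injEq] at e
      rw [e.1, e.2] at h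
      rw [e.2]
      exact exists_mem_receive_dlvd h
    · rw [count_receive_of_ne e] at h
      obtain ⟨m', h⟩ := hs.exists_dlvd _ _ h
      exact ⟨m', mem_receive_dlvd.2 (Or.inl h)⟩

end KLState

/-! ### Histories of a `kℓ`-cast object -/

/-- `σ t p` is the state at time `t` of a `kℓ`-cast object with `single` true at the process `p`,
`cast t p m id` says that `p` `kℓ`-casts `(m, id)` at time `t`, and `recv t p q m id` that it
receives `msg(m, id)` from `q`. -/
structure KLTrace {n : ℕ} {A I : Type*} (P : KLParams) (tb tm : ℕ) (C : Finset (Fin n))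
    (σ : ℕ → Fin n → KLState n A I) (cast : ℕ → Fin n → A → I → Prop)
    (recv : ℕ → Fin n → Fin n → A → I → Prop) : Prop where
  card_compl_le : Cᶜ.card ≤ tb
  single : P.single = true
  qf_eq : P.qf = tb + 1
  lt_qd : tb < P.qd
  start : ∀ p, σ 0 p = KLState.empty n A I
  step : ∀ t, ∀ p ∈ C, σ (t + 1) p = σ t p ∨
    (∃ m id, cast t p m id ∧ σ (t + 1) p = ((σ t p).klCast m id).1) ∨
    ∃ q m id, recv t p q m id ∧ σ (t + 1) p = ((σ t p).receive P q m id).1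
  of_cast : ∀ t, ∀ p ∈ C, ∀ m id, cast t p m id → σ (t + 1) p = ((σ t p).klCast m id).1
  of_recv : ∀ t, ∀ p ∈ C, ∀ q m id, recv t p q m id →
    σ (t + 1) p = ((σ t p).receive P q m id).1
  sent_of_recv : ∀ t, ∀ p ∈ C, ∀ q ∈ C, ∀ m id, recv t p q m id → (m, id) ∈ (σ t q).sent
  recv_of_sent : ∀ t, ∀ p ∈ C, ∀ m id, (m, id) ∉ (σ t p).sent → (m, id) ∈ (σ (t + 1) p).sent →
    ∃ D : Finset (Fin n), D.card ≤ tm ∧ ∀ q ∈ C, q ∉ D → ∃ t', recv t' q p m id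

namespace KLTrace

variable {n : ℕ} {A I : Type*} {P : KLParams} {tb tm : ℕ} {C : Finset (Fin n)}
  {σ : ℕ → Fin n → KLState n A I} {cast : ℕ → Fin n → A → I → Prop}
  {recv : ℕ → Fin n → Fin n → A → I → Prop}

theorem step_mono (h : KLTrace P tb tm C σ cast recv) (t : ℕ) {p : Fin n} (hp : p ∈ C) :
    (σ t p).sent ⊆ (σ (t + 1) p).sent ∧ (σ t p).rcvd ⊆ (σ (t + 1) p).rcvd ∧
      (σ t p).dlvd ⊆ (σ (t + 1) p).dlvd := by
  rcases h.step t p hp with e | ⟨m, id, -, e⟩ | ⟨q, m, id, -, e⟩ <;> rw [e]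
  · exact ⟨subset_rfl, subset_rfl, subset_rfl⟩
  · exact ⟨fun x hx => KLState.mem_klCast_sent.2 (Or.inl hx), by simp, by simp⟩
  · exact ⟨fun x hx => KLState.mem_receive_sent.2 (Or.inl hx), by simp,
      fun x hx => KLState.mem_receive_dlvd.2 (Or.inl hx)⟩

theorem sent_mono (h : KLTrace P tb tm C σ cast recv) {p : Fin n} (hp : p ∈ C) :
    Monotone fun t => (σ t p).sent :=
  monotone_nat_of_le_succ fun t => (h.step_mono t hp).1

theorem rcvd_mono (h : KLTrace P tb tm C σ cast recv) {p : Fin n} (hp : p ∈ C) :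
    Monotone fun t => (σ t p).rcvd :=
  monotone_nat_of_le_succ fun t => (h.step_mono t hp).2.1

theorem dlvd_mono (h : KLTrace P tb tm C σ cast recv) {p : Fin n} (hp : p ∈ C) :
    Monotone fun t => (σ t p).dlvd :=
  monotone_nat_of_le_succ fun t => (h.step_mono t hp).2.2

theorem inv (h : KLTrace P tb tm C σ cast recv) (t : ℕ) {p : Fin n} (hp : p ∈ C) :
    (σ t p).Inv P := by
  induction t with
  | zero =>
    rw [h.start]
    exact KLState.inv_empty (by rw [h.qf_eq]; omega) (lt_of_le_of_lt (Nat.zero_le _) h.lt_qd)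
  | succ t ih =>
    rcases h.step t p hp with e | ⟨m, id, -, e⟩ | ⟨q, m, id, -, e⟩ <;> rw [e]
    · exact ih
    · exact ih.klCast
    · exact ih.receive h.single

theorem sent_unique (h : KLTrace P tb tm C σ cast recv) {t t' : ℕ} {p : Fin n} (hp : p ∈ C)
    {m m' : A} {id : I} (h1 : (m, id) ∈ (σ t p).sent) (h2 : (m', id) ∈ (σ t' p).sent) :
    m = m' :=
  (h.inv (max t t') hp).sent_unique _ _ _ (h.sent_mono hp (le_max_left t t') h1)
    (h.sent_mono hp (le_max_right t t') h2)

theorem dlvd_unique (h : KLTrace P tb tm C σ cast recv) {t t' : ℕ} {p : Fin n} (hp : p ∈ C)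
    {m m' : A} {id : I} (h1 : (m, id) ∈ (σ t p).dlvd) (h2 : (m', id) ∈ (σ t' p).dlvd) :
    m = m' :=
  (h.inv (max t t') hp).dlvd_unique _ _ _ (h.dlvd_mono hp (le_max_left t t') h1)
    (h.dlvd_mono hp (le_max_right t t') h2)

theorem exists_sent_of_cast (h : KLTrace P tb tm C σ cast recv) {t : ℕ} {p : Fin n} (hp : p ∈ C)
    {m : A} {id : I} (hc : cast t p m id) : ∃ m', (m', id) ∈ (σ (t + 1) p).sent := by
  rw [h.of_cast t p hp m id hc]
  exact KLState.exists_mem_klCast_sent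

theorem exists_recv_of_rcvd (h : KLTrace P tb tm C σ cast recv) {t : ℕ} {p q : Fin n}
    (hp : p ∈ C) {m : A} {id : I} (hr : (q, m, id) ∈ (σ t p).rcvd) :
    ∃ t' < t, recv t' p q m id := by
  induction t with
  | zero => simp [h.start, KLState.empty] at hr
  | succ t ih =>
    rcases h.step t p hp with e | ⟨m', id', -, e⟩ | ⟨q', m', id', hc, e⟩ <;> rw [e] at hr
    · obtain ⟨t', ht, hr⟩ := ih hr
      exact ⟨t', ht.trans t.lt_succ_self, hr⟩
    · rw [KLState.klCast_rcvd] at hr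
      obtain ⟨t', ht, hr⟩ := ih hr
      exact ⟨t', ht.trans t.lt_succ_self, hr⟩
    · rw [KLState.receive_rcvd] at hr
      rcases hr with hr | hr
      · simp only [Prod.mk.injEq] at hr
        obtain ⟨rfl, rfl, rfl⟩ := hr
        exact ⟨t, t.lt_succ_self, hc⟩
      · obtain ⟨t', ht, hr⟩ := ih hr
        exact ⟨t', ht.trans t.lt_succ_self, hr⟩

theorem sent_of_rcvd (h : KLTrace P tb tm C σ cast recv) {t : ℕ} {p q : Fin n} (hp : p ∈ C)
    (hq : q ∈ C) {m : A} {id : I} (hr : (q, m, id) ∈ (σ t p).rcvd) :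
    ∃ t' < t, (m, id) ∈ (σ t' q).sent := by
  obtain ⟨t', ht, hr⟩ := h.exists_recv_of_rcvd hp hr
  exact ⟨t', ht, h.sent_of_recv _ _ hp _ hq _ _ hr⟩

/-- A correct source must really have sent the message earlier; the other sources are Byzantine, so
there are at most `tb` of them. -/
theorem count_le (h : KLTrace P tb tm C σ cast recv) {t : ℕ} {p : Fin n} (hp : p ∈ C)
    {m : A} {id : I} {S : Finset (Fin n)}
    (hS : ∀ q ∈ C, ∀ t' < t, (m, id) ∈ (σ t' q).sent → q ∈ S) :
    (σ t p).count m id ≤ S.card + tb := by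
  calc (σ t p).count m id ≤ ((S ∪ Cᶜ : Finset (Fin n)) : Set (Fin n)).ncard := by
        refine Set.ncard_le_ncard (fun q hq => ?_) (Set.toFinite _)
        by_cases hqC : q ∈ C
        · obtain ⟨t', ht, hs⟩ := h.sent_of_rcvd hp hqC hq
          simp [hS q hqC t' ht hs]
        · simp [hqC]
    _ = (S ∪ Cᶜ).card := Set.ncard_coe_finset _
    _ ≤ S.card + Cᶜ.card := Finset.card_union_le _ _
    _ ≤ S.card + tb := Nat.add_le_add_left h.card_compl_le _

theorem exists_sent_of_lt_count (h : KLTrace P tb tm C σ cast recv) {t : ℕ} {p : Fin n}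
    (hp : p ∈ C) {m : A} {id : I} (hc : tb < (σ t p).count m id) :
    ∃ q ∈ C, ∃ t' < t, (m, id) ∈ (σ t' q).sent := by
  by_contra! hn
  have := h.count_le (S := ∅) hp (fun q hq t' ht hs => absurd hs (hn q hq t' ht))
  simp at this
  omega

/-- Forwarding needs `tb + 1` sources, one of which is correct and sent strictly earlier; strong
induction on time therefore ends at a cast. -/
theorem exists_cast_of_sent (h : KLTrace P tb tm C σ cast recv) {t : ℕ} {p : Fin n} (hp : p ∈ C)
    {m : A} {id : I} (hs : (m, id) ∈ (σ t p).sent) :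
    ∃ q ∈ C, ∃ t' < t, cast t' q m id := by
  induction t using Nat.strong_induction_on generalizing p with
  | _ t ih =>
    cases t with
    | zero => simp [h.start, KLState.empty] at hs
    | succ t =>
      have weaken : (∃ q ∈ C, ∃ t' < t, cast t' q m id) → ∃ q ∈ C, ∃ t' < t + 1, cast t' q m id :=
        fun ⟨q, hq, t', ht, hc⟩ => ⟨q, hq, t', ht.trans t.lt_succ_self, hc⟩
      rcases h.step t p hp with e | ⟨m', id', hc, e⟩ | ⟨q', m', id', hc, e⟩
      · exact weaken (ih t t.lt_succ_self hp (e ▸ hs))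
      · rw [e, KLState.mem_klCast_sent] at hs
        rcases hs with hs | hs
        · exact weaken (ih t t.lt_succ_self hp hs)
        · obtain ⟨hx, -⟩ := KLState.klCast_eq_some hs
          simp only [Prod.mk.injEq] at hx
          obtain ⟨rfl, rfl⟩ := hx
          exact ⟨p, hp, t, t.lt_succ_self, hc⟩
      · rw [e, KLState.mem_receive_sent] at hs
        rcases hs with hs | hs
        · exact weaken (ih t t.lt_succ_self hp hs)
        · obtain ⟨hx, hq, -⟩ := KLState.receive_forward_eq_some h.single hs
          simp only [Prod.mk.injEq] at hx
          obtain ⟨rfl, rfl⟩ := hx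
          rw [← e, h.qf_eq] at hq
          obtain ⟨q, hqC, t', ht, hs'⟩ := h.exists_sent_of_lt_count hp hq
          obtain ⟨r, hr, t'', ht', hc'⟩ := ih t' ht hqC hs'
          exact ⟨r, hr, t'', ht'.trans ht, hc'⟩

theorem exists_sent_of_dlvd (h : KLTrace P tb tm C σ cast recv) {t : ℕ} {p : Fin n} (hp : p ∈ C)
    {m : A} {id : I} (hd : (m, id) ∈ (σ t p).dlvd) :
    ∃ q ∈ C, ∃ t' < t, (m, id) ∈ (σ t' q).sent :=
  h.exists_sent_of_lt_count hp (h.lt_qd.trans_le ((h.inv t hp).le_count _ _ hd))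

/-- Two quorums of size `qd` among `n` processes meet in at least `2 * qd - n > tb` processes. One
of these is correct, and it would have sent both messages under one identity. -/
theorem dlvd_agree (h : KLTrace P tb tm C σ cast recv) (hq : n + tb < 2 * P.qd) {t t' : ℕ}
    {p p' : Fin n} (hp : p ∈ C) (hp' : p' ∈ C) {m m' : A} {id : I}
    (h1 : (m, id) ∈ (σ t p).dlvd) (h2 : (m', id) ∈ (σ t' p').dlvd) : m = m' := by
  by_contra hne
  have c1 := (h.inv t hp).le_count _ _ h1
  have c2 := (h.inv t' hp').le_count _ _ h2
  unfold KLState.count at c1 c2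
  set X := {j : Fin n | (j, m, id) ∈ (σ t p).rcvd}
  set Y := {j : Fin n | (j, m', id) ∈ (σ t' p').rcvd}
  have hXY : X ∩ Y ⊆ ((Cᶜ : Finset (Fin n)) : Set (Fin n)) := by
    rintro j ⟨hX, hY⟩
    simp only [Finset.coe_compl, Set.mem_compl_iff, Finset.mem_coe]
    intro hj
    obtain ⟨_, -, hs⟩ := h.sent_of_rcvd hp hj hX
    obtain ⟨_, -, hs'⟩ := h.sent_of_rcvd hp' hj hY
    exact hne (h.sent_unique hj hs hs')
  have e1 := Set.ncard_union_add_ncard_inter X Y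
  have e2 : (X ∩ Y).ncard ≤ tb := by
    refine (Set.ncard_le_ncard hXY (Set.toFinite _)).trans ?_
    rw [Set.ncard_coe_finset]
    exact h.card_compl_le
  have e3 : (X ∪ Y).ncard ≤ n := by
    simpa using Set.ncard_le_ncard (Set.subset_univ (X ∪ Y)) (Set.toFinite _)
  omega

/-! ### Double counting of the receptions between correct processes. -/

open Classical in
/-- The correct processes that eventually ur-broadcast `msg(m, id)`. -/
noncomputable def senders (C : Finset (Fin n)) (σ : ℕ → Fin n → KLState n A I) (m : A) (id : I) :
    Finset (Fin n) :=
  C.filter fun p => ∃ t, (m, id) ∈ (σ t p).sent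

open Classical in
/-- The correct processes that eventually `kℓ`-deliver `(m, id)`. -/
noncomputable def deliverers (C : Finset (Fin n)) (σ : ℕ → Fin n → KLState n A I) (m : A)
    (id : I) : Finset (Fin n) :=
  C.filter fun p => ∃ t, (m, id) ∈ (σ t p).dlvd

theorem mem_senders {m : A} {id : I} {p : Fin n} :
    p ∈ senders C σ m id ↔ p ∈ C ∧ ∃ t, (m, id) ∈ (σ t p).sent := by
  simp [senders]

theorem mem_deliverers {m : A} {id : I} {p : Fin n} :
    p ∈ deliverers C σ m id ↔ p ∈ C ∧ ∃ t, (m, id) ∈ (σ t p).dlvd := by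
  simp [deliverers]

theorem qd_le_card_senders_add (h : KLTrace P tb tm C σ cast recv) {t : ℕ} {p : Fin n}
    (hp : p ∈ C) {m : A} {id : I} (hd : (m, id) ∈ (σ t p).dlvd) :
    P.qd ≤ (senders C σ m id).card + tb :=
  ((h.inv t hp).le_count _ _ hd).trans
    (h.count_le hp fun _ hq t' _ hs => mem_senders.2 ⟨hq, t', hs⟩)

/-- Receptions are never forgotten, so the latest of finitely many reception times serves for all of
`F`. -/
theorem exists_card_le_count (h : KLTrace P tb tm C σ cast recv) {p : Fin n} (hp : p ∈ C)
    {m : A} {id : I} (F : Finset (Fin n)) (hF : ∀ q ∈ F, ∃ t, (q, m, id) ∈ (σ t p).rcvd) :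
    ∃ t, F.card ≤ (σ t p).count m id := by
  choose! τ hτ using hF
  refine ⟨F.sup τ, ?_⟩
  rw [← Set.ncard_coe_finset]
  exact Set.ncard_le_ncard (fun q hq => h.rcvd_mono hp (Finset.le_sup hq) (hτ q hq))
    (Set.toFinite _)

/-- Reaching the forwarding threshold only ensures that something was sent under `id`; `hm`
identifies it as `m`. -/
theorem mem_senders_of_card (h : KLTrace P tb tm C σ cast recv) {m : A} {id : I}
    (hm : ∀ m', ∀ q ∈ C, ∀ t, (m', id) ∈ (σ t q).sent → m' = m) {p : Fin n} (hp : p ∈ C)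
    {F : Finset (Fin n)} (hF : ∀ q ∈ F, ∃ t, (q, m, id) ∈ (σ t p).rcvd) (hcard : tb < F.card) :
    p ∈ senders C σ m id := by
  obtain ⟨t, ht⟩ := h.exists_card_le_count hp F hF
  obtain ⟨m', hs⟩ := (h.inv t hp).exists_sent m id (by rw [h.qf_eq]; omega)
  obtain rfl := hm m' p hp t hs
  exact mem_senders.2 ⟨hp, t, hs⟩

/-- The threshold ensures some delivery under `id`. Since `qd > tb`, the delivered message was sent
by a correct process, so `hm` applies to it. -/
theorem mem_deliverers_of_card (h : KLTrace P tb tm C σ cast recv) {m : A} {id : I}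
    (hm : ∀ m', ∀ q ∈ C, ∀ t, (m', id) ∈ (σ t q).sent → m' = m) {p : Fin n} (hp : p ∈ C)
    {F : Finset (Fin n)} (hF : ∀ q ∈ F, ∃ t, (q, m, id) ∈ (σ t p).rcvd)
    (hcard : P.qd ≤ F.card) : p ∈ deliverers C σ m id := by
  obtain ⟨t, ht⟩ := h.exists_card_le_count hp F hF
  obtain ⟨m', hd⟩ := (h.inv t hp).exists_dlvd m id (hcard.trans ht)
  obtain ⟨q, hq, t', -, hs⟩ := h.exists_sent_of_dlvd hp hd
  obtain rfl := hm m' q hq t' hs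
  exact mem_deliverers.2 ⟨hp, t, hd⟩

/-- Because `qd ≥ tb + 1 = qf`, a process that meets the delivery quorum also meets the forwarding
one. -/
theorem deliverers_subset_senders (h : KLTrace P tb tm C σ cast recv) {m : A} {id : I}
    (hm : ∀ m', ∀ q ∈ C, ∀ t, (m', id) ∈ (σ t q).sent → m' = m) :
    deliverers C σ m id ⊆ senders C σ m id := by
  intro p hpD
  obtain ⟨hp, t, hd⟩ := mem_deliverers.1 hpD
  have := (h.inv t hp).le_count _ _ hd
  have := h.lt_qd
  obtain ⟨m', hs⟩ := (h.inv t hp).exists_sent m id (by rw [h.qf_eq]; omega)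
  obtain rfl := hm m' p hp t hs
  exact mem_senders.2 ⟨hp, t, hs⟩

open Classical in
/-- The correct processes from which `p` eventually receives `msg(m, id)`. -/
noncomputable def sources (C : Finset (Fin n)) (σ : ℕ → Fin n → KLState n A I) (m : A) (id : I)
    (p : Fin n) : Finset (Fin n) :=
  (senders C σ m id).bipartiteAbove (fun p q => ∃ t, (q, m, id) ∈ (σ t p).rcvd) p

theorem exists_not_sent_sent (h : KLTrace P tb tm C σ cast recv) {p : Fin n} {x : A × I} {t : ℕ}
    (hs : x ∈ (σ t p).sent) : ∃ t', x ∉ (σ t' p).sent ∧ x ∈ (σ (t' + 1) p).sent := by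
  induction t with
  | zero => simp [h.start, KLState.empty] at hs
  | succ t ih =>
    by_cases hx : x ∈ (σ t p).sent
    · exact ih hx
    · exact ⟨t, hx, hs⟩

/-- The pairs (receiver, sender) are counted from the side of the senders: the adversary removes at
most `tm` correct recipients from each. -/
theorem card_mul_le_sum_card_sources (h : KLTrace P tb tm C σ cast recv) (m : A) (id : I) :
    (senders C σ m id).card * (C.card - tm) ≤ ∑ p ∈ C, (sources C σ m id p).card := by
  classical
  unfold sources
  rw [Finset.sum_card_bipartiteAbove_eq_sum_card_bipartiteBelow, ← smul_eq_mul]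
  refine Finset.card_nsmul_le_sum _ _ _ fun q hq => ?_
  obtain ⟨hq, t, hs⟩ := mem_senders.1 hq
  obtain ⟨t', h1, h2⟩ := h.exists_not_sent_sent hs
  obtain ⟨D, hD, hr⟩ := h.recv_of_sent t' q hq m id h1 h2
  calc C.card - tm ≤ C.card - D.card := Nat.sub_le_sub_left hD _
    _ ≤ (C \ D).card := Finset.le_card_sdiff _ _
    _ ≤ _ := by
      refine Finset.card_le_card fun p hp => ?_
      obtain ⟨hp, hpD⟩ := Finset.mem_sdiff.1 hp
      obtain ⟨u, hu⟩ := hr p hp hpD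
      refine (Finset.mem_bipartiteBelow _).2 ⟨hp, u + 1, ?_⟩
      rw [h.of_recv u p hp q m id hu, KLState.receive_rcvd]
      exact Set.mem_insert _ _

theorem rcvd_of_mem_sources {m : A} {id : I} {p q : Fin n} (hq : q ∈ sources C σ m id p) :
    ∃ t, (q, m, id) ∈ (σ t p).rcvd := by
  classical
  unfold sources at hq
  exact ((Finset.mem_bipartiteAbove _).1 hq).2

theorem card_sources_le (m : A) (id : I) (p : Fin n) :
    (sources C σ m id p).card ≤ (senders C σ m id).card := by
  classical
  exact Finset.card_le_card (Finset.filter_subset _ _)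

/-- The same pairs counted from the side of the receivers: a sender hears at most all senders, and a
non-sender stays below the forwarding threshold. -/
theorem card_mul_le (h : KLTrace P tb tm C σ cast recv) {m : A} {id : I}
    (hm : ∀ m', ∀ q ∈ C, ∀ t, (m', id) ∈ (σ t q).sent → m' = m) :
    (senders C σ m id).card * (C.card - tm) ≤
      (senders C σ m id).card * (senders C σ m id).card +
        (C.card - (senders C σ m id).card) * tb := by
  have hSC : senders C σ m id ⊆ C := fun p hp => (mem_senders.1 hp).1
  refine (h.card_mul_le_sum_card_sources m id).trans ?_
  rw [← Finset.sum_sdiff hSC, add_comm]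
  refine Nat.add_le_add ?_ ?_
  · exact Finset.sum_le_card_nsmul _ _ _ fun p _ => card_sources_le m id p
  · rw [← Finset.card_sdiff_of_subset hSC]
    refine Finset.sum_le_card_nsmul _ _ _ fun p hp => ?_
    obtain ⟨hp, hpS⟩ := Finset.mem_sdiff.1 hp
    by_contra! hlt
    exact hpS (h.mem_senders_of_card hm hp (fun q hq => rcvd_of_mem_sources hq) hlt)

/-- Refines the receiver side by separating the senders that never deliver, each of which hears at
most `qd - 1` correct senders. -/
theorem card_mul_le_deliverers (h : KLTrace P tb tm C σ cast recv) {m : A} {id : I}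
    (hm : ∀ m', ∀ q ∈ C, ∀ t, (m', id) ∈ (σ t q).sent → m' = m) :
    (senders C σ m id).card * (C.card - tm) ≤
      (deliverers C σ m id).card * (senders C σ m id).card +
        ((senders C σ m id).card - (deliverers C σ m id).card) * (P.qd - 1) +
        (C.card - (senders C σ m id).card) * tb := by
  have hSC : senders C σ m id ⊆ C := fun p hp => (mem_senders.1 hp).1
  have hDS := h.deliverers_subset_senders hm
  refine (h.card_mul_le_sum_card_sources m id).trans ?_
  rw [← Finset.sum_sdiff hSC, add_comm, ← Finset.sum_sdiff hDS,
    add_comm (∑ p ∈ senders C σ m id \ _, _)]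
  refine Nat.add_le_add (Nat.add_le_add ?_ ?_) ?_
  · exact Finset.sum_le_card_nsmul _ _ _ fun p _ => card_sources_le m id p
  · rw [← Finset.card_sdiff_of_subset hDS]
    refine Finset.sum_le_card_nsmul _ _ _ fun p hp => ?_
    obtain ⟨hp, hpD⟩ := Finset.mem_sdiff.1 hp
    by_contra! hlt
    exact hpD (h.mem_deliverers_of_card hm (hSC hp) (F := sources C σ m id p)
      (fun q hq => rcvd_of_mem_sources hq) (by omega))
  · rw [← Finset.card_sdiff_of_subset hSC]
    refine Finset.sum_le_card_nsmul _ _ _ fun p hp => ?_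
    obtain ⟨hp, hpS⟩ := Finset.mem_sdiff.1 hp
    by_contra! hlt
    exact hpS (h.mem_senders_of_card hm hp (fun q hq => rcvd_of_mem_sources hq) hlt)

end KLTrace

/-! ### Real inequalities on the numbers of senders and deliverers. -/

section Quorum

variable {c b a s k l q : ℝ}

/-- Here `c`, `k`, `l` count correct processes, senders and deliverers, `b = tb`, `a = tm` and `q =
qd - 1`. With `A = c - a - q + b`, the count `hl` gives `l ≥ (A k - c b) / (k - q)`, which is
nonincreasing in `k > q` exactly when `c b ≤ A q`; the conclusion is its value at `k = c`. -/
theorem mul_le_mul_of_quorum (hk : q < k) (hkc : k ≤ c)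
    (hq : c * b ≤ (c - a - q + b) * q)
    (hl : k * (c - a) ≤ l * k + (k - l) * q + (c - k) * b) :
    c * (c - q - a) ≤ l * (c - q) := by
  have h1 : k * (c - a - q + b) - c * b ≤ l * (k - q) := by linarith
  -- This product equals `(c - q) (A k - c b) - c (c - q - a) (k - q)`.
  have h2 : 0 ≤ (c - k) * ((c - a - q + b) * q - c * b) :=
    mul_nonneg (by linarith) (by linarith)
  have h3 := mul_le_mul_of_nonneg_right h1 (by linarith : 0 ≤ c - q)
  refine le_of_mul_le_mul_right (a := k - q) ?_ (by linarith)
  linarith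

/-- The claim amounts to `(2a + b)(2b + a) ≤ c (a + b)`. The lower bound on `c` gives `2 (a + b)² +
2 s (a + b)` on the right, and `2 s ≤ a + b` makes the last term at least `4 a b`. -/
theorem ready_quorum (hb : 0 ≤ b) (ha : 0 ≤ a) (hs : 0 ≤ s) (hss : s * s = b * a)
    (hc : 2 * b + 2 * a + 2 * s < c) : c * b ≤ (c - a - (2 * b + a) + b) * (2 * b + a) := by
  have h1 : 2 * s ≤ b + a := by nlinarith [sq_nonneg (b - a)]
  nlinarith [mul_le_mul_of_nonneg_right hc.le (add_nonneg hb ha),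
    mul_le_mul_of_nonneg_right h1 hs]

/-- The right side is concave in `q`, so the two ends of the allowed interval decide. The upper end
needs `4 a b ≤ c (c - 2b - 2a)`; at the lower end the extra `1` in `hc'` pays for the rounding of
the quorum. -/
theorem echo_quorum (hb : 0 ≤ b) (ha : 0 ≤ a)
    (hc' : 4 * (b * a) + 1 ≤ c * (c - 2 * b - 2 * a))
    (hq : q ≤ (c + 2 * b) / 2) (hq' : (c + b - 1) / 2 ≤ q) :
    c * b ≤ (c - a - q + b) * q := by
  nlinarith [mul_nonneg (sub_nonneg.2 hq) (sub_nonneg.2 hq'), mul_nonneg hb ha, mul_nonneg hb hb]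

/-- The count `hl` says that the convex quadratic `(k - b)(k - c) + k a` is nonnegative. It is
negative at `k = b + a + 1` (`e1`) and at `k = 2b + a` (`e2`), hence between them (`e3` is the chord
bound), so `k` lies beyond. For `b = 0` the lower bound on `k` suffices. -/
theorem ready_lt_card (hb : 0 ≤ b) (ha : 0 ≤ a) (hs : 0 ≤ s) (hss : s * s = b * a)
    (hc : 2 * b + 2 * a + 2 * s < c)
    (hk1 : b + a + 1 ≤ k) (hb1 : b = 0 ∨ 1 ≤ b)
    (hc1 : 2 * b + 2 * a + 1 ≤ c)
    (hl : k * (c - a) ≤ k * k + (c - k) * b) : 2 * b + a < k := by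
  rcases hb1 with rfl | hb1
  · linarith
  by_contra! hk2
  have e0 : 0 ≤ (k - b) * (k - c) + k * a := by linarith
  have e1 : (a + 1) * (b + a + 1 - c) + (b + a + 1) * a < 0 := by nlinarith
  have e2 : (b + a) * (2 * b + a - c) + (2 * b + a) * a < 0 := by
    nlinarith [mul_lt_mul_of_pos_left hc (by linarith : 0 < b + a),
      mul_nonneg hs (add_nonneg hb ha), mul_nonneg hb ha, sq_nonneg (b - a),
      show 2 * s ≤ b + a by nlinarith [sq_nonneg (b - a)]]
  have e3 : (k - b) * (k - c) + k * a ≤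
      (b + a + 1 - c + b + 2 * a) * k + (b * c - (b + a + 1) * (2 * b + a)) := by
    nlinarith [mul_nonneg (sub_nonneg.2 hk1) (sub_nonneg.2 hk2)]
  rcases le_total 0 (b + a + 1 - c + b + 2 * a) with h | h
  · nlinarith [mul_le_mul_of_nonneg_left hk2 h]
  · nlinarith [mul_le_mul_of_nonpos_left hk1 h]

/-- `hl` is the ready count with no deliverer. With `x = c - qE - a` and `y = c - 2b - 2a`,
combining it with the echo bound gives `x (y + b) ≤ b (x + a)`, that is `x y ≤ a b`, whereas `x > s`
and `y > 2 s` give `x y > 2 a b`. -/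
theorem ready_trigger {lE qE : ℝ} (hb : 0 ≤ b) (ha : 0 ≤ a) (hs : 0 ≤ s) (hss : s * s = b * a)
    (hc : 2 * b + 2 * a + 2 * s < c)
    (hqE : qE ≤ (c + 2 * b) / 2)
    (hE : c * (c - qE - a) ≤ lE * (c - qE)) (hk : lE ≤ k)
    (hl : k * (c - a) ≤ k * (2 * b + a) + (c - k) * b) : False := by
  have hx : s < c - qE - a := by linarith
  have hy : 2 * s < c - 2 * b - 2 * a := by linarith
  have h1 : k * (c - b - 2 * a) ≤ c * b := by linarith
  have h2 : c * (c - qE - a) ≤ k * (c - qE) :=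
    hE.trans (mul_le_mul_of_nonneg_right hk (by linarith))
  have h3 := mul_le_mul_of_nonneg_right h2 (by linarith : 0 ≤ c - b - 2 * a)
  have h4 := mul_le_mul_of_nonneg_right h1 (by linarith : 0 ≤ c - qE)
  have h5 : c * ((c - qE - a) * (c - b - 2 * a)) ≤ c * (b * (c - qE)) := by linarith
  have h6 := le_of_mul_le_mul_left h5 (by linarith)
  have h7 : s * (2 * s) < (c - qE - a) * (c - 2 * b - 2 * a) :=
    mul_lt_mul'' hx hy hs (by linarith)
  nlinarith [mul_nonneg hb ha]

end Quorum

/-! ### Local moves -/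

variable {n : ℕ} {M : Type*}

/-- `Act tb tm p e s r`: the event `e` is a move of the process `p` from the local state `s`, to the
local state `r.1`, in which it ur-broadcasts `r.2`, if any. -/
inductive Act (tb tm : ℕ) (p : Fin n) :
    Event n M → LocalState n M → LocalState n M × Option (ImpMsg n M) → Prop
  | broadcast (m : M) (sn : ℕ) (s : LocalState n M) :
      Act tb tm p (.broadcast p m sn) s (s, some (.init m sn))
  | receive (q : Fin n) (msg : ImpMsg n M) (s : LocalState n M) :
      Act tb tm p (.receive p q msg) s (s.receive tb tm q msg)
  | echoDelivered (m : M) (id : AppId n) (s : LocalState n M) (up : Multiset (M × AppId n))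
      (h : s.echoUp = (m, id) ::ₘ up) :
      Act tb tm p (.echoDelivered p m id) s (LocalState.castReady { s with echoUp := up } m id)
  | readyDelivered (m : M) (id : AppId n) (s : LocalState n M) (up : Multiset (M × AppId n))
      (h : s.readyUp = (m, id) ::ₘ up) :
      Act tb tm p (.readyDelivered p m id) s ({ s with readyUp := up }, none)

/-- The process that makes a move at an event. -/
def Event.actor : Event n M → Option (Fin n)
  | .idle => none
  | .byzSend _ _ _ => none
  | .broadcast p _ _ => some p
  | .receive p _ _ => some p
  | .echoDelivered p _ _ => some p
  | .readyDelivered p _ _ => some p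

section

variable {tb tm : ℕ} {C : Finset (Fin n)} {c c' : Config n M} {e : Event n M} {p : Fin n}
  {s : LocalState n M} {r : LocalState n M × Option (ImpMsg n M)} {m : M} {id : AppId n}

theorem LocalMove.spec {net : Multiset (Packet n M)} (h : LocalMove tm C c net p r c') :
    c'.loc p = r.1 ∧ (∀ q ≠ p, c'.loc q = c.loc q) ∧
      (∀ msg, r.2 = some msg →
        ∃ D : Finset (Fin n), D.card ≤ tm ∧ ∀ d ∉ D, (p, d, msg) ∈ c'.net) ∧
      ∀ x ∈ c'.net, x ∈ net ∨ x.1 = p ∧ r.2 = some x.2.2 := by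
  obtain ⟨h1, h2⟩ := h
  refine ⟨by simp [h1], fun q hq => by simp [h1, hq], ?_⟩
  cases hr : r.2 with
  | none =>
    rw [hr] at h2
    change c'.net = net at h2
    exact ⟨by simp, fun x hx => Or.inl (h2 ▸ hx)⟩
  | some msg =>
    rw [hr] at h2
    obtain ⟨D, -, hD, hnet⟩ := h2
    refine ⟨?_, ?_⟩
    · rintro _ ⟨rfl⟩
      refine ⟨D, hD, fun d hd => ?_⟩
      rw [hnet, Multiset.mem_add]
      exact Or.inr (Multiset.mem_map.2 ⟨d, by rw [Finset.mem_val]; simp [hd], rfl⟩)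
    · intro x hx
      rw [hnet, Multiset.mem_add, Multiset.mem_map] at hx
      rcases hx with hx | ⟨d, -, rfl⟩
      · exact Or.inl hx
      · exact Or.inr ⟨rfl, rfl⟩

theorem Step.exists_act (h : Step tb tm C c e c') (hp : e.actor = some p) :
    p ∈ C ∧ ∃ r net, net ≤ c.net ∧ Act tb tm p e (c.loc p) r ∧ LocalMove tm C c net p r c' := by
  cases e with
  | idle => simp [Event.actor] at hp
  | byzSend => simp [Event.actor] at hp
  | broadcast p' m sn =>
    obtain rfl : p' = p := by simpa [Event.actor] using hp
    exact ⟨h.1, _, _, le_rfl, .broadcast m sn _, h.2⟩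
  | receive p' q msg =>
    obtain rfl : p' = p := by simpa [Event.actor] using hp
    obtain ⟨h1, net, h2, h3⟩ := h
    exact ⟨h1, _, net, by rw [h2]; exact Multiset.le_cons_self _ _, .receive q msg _, h3⟩
  | echoDelivered p' m id =>
    obtain rfl : p' = p := by simpa [Event.actor] using hp
    obtain ⟨h1, up, h2, h3⟩ := h
    exact ⟨h1, _, _, le_rfl, .echoDelivered m id _ up h2, h3⟩
  | readyDelivered p' m id =>
    obtain rfl : p' = p := by simpa [Event.actor] using hp
    obtain ⟨h1, up, h2, h3⟩ := h
    exact ⟨h1, _, _, le_rfl, .readyDelivered m id _ up h2, h3⟩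

theorem Step.loc_eq (h : Step tb tm C c e c') (hp : e.actor ≠ some p) : c'.loc p = c.loc p := by
  cases hq : e.actor with
  | some q =>
    obtain ⟨-, r, net, -, -, hm⟩ := h.exists_act hq
    exact hm.spec.2.1 p (fun hpq => hp (by rw [hq, hpq]))
  | none =>
    cases e <;> simp [Event.actor] at hq
    · rw [show c' = c from h]
    · rw [h.2]

/-- Authentication: Byzantine processes insert packets only under their own names, so a new packet
with a correct source comes from a move of that source. -/
theorem Step.mem_net (h : Step tb tm C c e c') {x : Packet n M} (hx : x ∈ c'.net)
    (hC : x.1 ∈ C) : x ∈ c.net ∨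
      ∃ r, Act tb tm x.1 e (c.loc x.1) r ∧ r.2 = some x.2.2 ∧ c'.loc x.1 = r.1 := by
  cases hq : e.actor with
  | some q =>
    obtain ⟨-, r, net, hnet, ha, hm⟩ := h.exists_act hq
    rcases hm.spec.2.2.2 x hx with hx | ⟨rfl, hr⟩
    · exact Or.inl (Multiset.mem_of_le hnet hx)
    · exact Or.inr ⟨r, ha, hr, hm.spec.1⟩
  | none =>
    left
    cases e <;> simp [Event.actor] at hq
    · rwa [show c' = c from h] at hx
    · obtain ⟨h1, rfl⟩ := h
      rcases Multiset.mem_cons.1 hx with rfl | hx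
      · exact absurd hC h1
      · exact hx

theorem Step.act (h : Step tb tm C c e c') (p : Fin n) :
    (e.actor ≠ some p ∧ c'.loc p = c.loc p) ∨
      e.actor = some p ∧ ∃ r, Act tb tm p e (c.loc p) r ∧ c'.loc p = r.1 ∧ ∀ msg, r.2 = some msg →
        ∃ D : Finset (Fin n), D.card ≤ tm ∧ ∀ d ∉ D, (p, d, msg) ∈ c'.net := by
  by_cases hp : e.actor = some p
  · obtain ⟨-, r, net, -, ha, hm⟩ := h.exists_act hp
    exact Or.inr ⟨hp, r, ha, hm.spec.1, hm.spec.2.2.1⟩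
  · exact Or.inl ⟨hp, h.loc_eq hp⟩

theorem Act.echoObj (h : Act tb tm p e s r) :
    (r.1.echoObj = s.echoObj ∧ (∀ q m sn, e ≠ .receive p q (.init m sn)) ∧
        ∀ q m id, e ≠ .receive p q (.echo m id)) ∨
      (∃ q m sn, e = .receive p q (.init m sn) ∧
        r.1.echoObj = (s.echoObj.klCast m (sn, q)).1) ∨
      ∃ q m id, e = .receive p q (.echo m id) ∧
        r.1.echoObj = (s.echoObj.receive (echoParams n tb) q m id).1 := by
  cases h with
  | receive q msg => cases msg <;> simp [LocalState.receive, -Prod.exists]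
  | _ => simp [LocalState.castReady, -Prod.exists]

theorem Act.readyObj (h : Act tb tm p e s r) :
    (r.1.readyObj = s.readyObj ∧ (∀ m id, e ≠ .echoDelivered p m id) ∧
        ∀ q m id, e ≠ .receive p q (.ready m id)) ∨
      (∃ m id, e = .echoDelivered p m id ∧
        r.1.readyObj = (s.readyObj.klCast m id).1) ∨
      ∃ q m id, e = .receive p q (.ready m id) ∧
        r.1.readyObj = (s.readyObj.receive (readyParams tb tm) q m id).1 := by
  cases h with
  | receive q msg => cases msg <;> simp [LocalState.receive, -Prod.exists]
  | _ => simp [LocalState.castReady, -Prod.exists]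

theorem Act.eq_broadcast {sn : ℕ} (h : Act tb tm p e s r) (hr : r.2 = some (.init m sn)) :
    e = .broadcast p m sn := by
  cases h with
  | receive q msg => cases msg <;> simp [LocalState.receive] at hr
  | _ => simp_all [LocalState.castReady]

theorem Act.echo_mem_sent (h : Act tb tm p e s r) (hr : r.2 = some (.echo m id)) :
    (m, id) ∈ r.1.echoObj.sent := by
  cases h with
  | receive q msg =>
    cases msg <;> simp [LocalState.receive] at hr ⊢
    · exact KLState.mem_klCast_sent.2 (Or.inr hr)
    · exact KLState.mem_receive_sent.2 (Or.inr hr)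
  | _ => simp_all [LocalState.castReady]

theorem Act.ready_mem_sent (h : Act tb tm p e s r) (hr : r.2 = some (.ready m id)) :
    (m, id) ∈ r.1.readyObj.sent := by
  cases h with
  | receive q msg =>
    cases msg <;> simp [LocalState.receive] at hr ⊢
    exact KLState.mem_receive_sent.2 (Or.inr hr)
  | echoDelivered =>
    simp [LocalState.castReady] at hr ⊢
    exact KLState.mem_klCast_sent.2 (Or.inr hr)
  | _ => simp_all

theorem Act.eq_some_echo (h : Act tb tm p e s r) (h1 : (m, id) ∉ s.echoObj.sent)
    (h2 : (m, id) ∈ r.1.echoObj.sent) : r.2 = some (.echo m id) := by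
  cases h with
  | receive q msg =>
    cases msg <;> simp [LocalState.receive] at h2 ⊢
    · exact (KLState.mem_klCast_sent.1 h2).resolve_left h1
    · exact (KLState.mem_receive_sent.1 h2).resolve_left h1
    · exact absurd h2 h1
  | _ => exact absurd h2 h1

theorem Act.eq_some_ready (h : Act tb tm p e s r) (h1 : (m, id) ∉ s.readyObj.sent)
    (h2 : (m, id) ∈ r.1.readyObj.sent) : r.2 = some (.ready m id) := by
  cases h with
  | receive q msg =>
    cases msg <;> simp [LocalState.receive] at h2 ⊢
    · exact absurd h2 h1
    · exact absurd h2 h1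
    · exact (KLState.mem_receive_sent.1 h2).resolve_left h1
  | echoDelivered =>
    simp [LocalState.castReady] at h2 ⊢
    exact (KLState.mem_klCast_sent.1 h2).resolve_left h1
  | _ => exact absurd h2 h1

theorem Act.mem_echoUp (h : Act tb tm p e s r) (hu : (m, id) ∈ r.1.echoUp) :
    (m, id) ∈ s.echoUp ∨ (m, id) ∈ r.1.echoObj.dlvd := by
  cases h with
  | receive q msg =>
    cases msg with
    | echo m' id' =>
      simp only [LocalState.receive] at hu ⊢
      rw [KLState.mem_receive_dlvd]
      cases ho : (s.echoObj.receive (echoParams n tb) q m' id').2.2 <;> simp [ho] at hu ⊢ <;>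
        grind
    | _ => exact Or.inl hu
  | echoDelivered m' id' s up h =>
    left
    rw [h]
    exact Multiset.mem_cons_of_mem hu
  | _ => exact Or.inl hu

theorem Act.mem_echoUp_of_dlvd (h : Act tb tm p e s r) (h1 : (m, id) ∉ s.echoObj.dlvd)
    (h2 : (m, id) ∈ r.1.echoObj.dlvd) : (m, id) ∈ r.1.echoUp := by
  cases h with
  | receive q msg =>
    cases msg with
    | echo m' id' =>
      simp only [LocalState.receive] at h2 ⊢
      rw [(KLState.mem_receive_dlvd.1 h2).resolve_left h1]
      simp
    | init => simp [LocalState.receive] at h2; exact absurd h2 h1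
    | _ => exact absurd h2 h1
  | _ => exact absurd h2 h1

/-- The `kℓ`-deliveries not handled yet by the `ready` layer: how they change at a move. -/
theorem Act.readyUp (h : Act tb tm p e s r) :
    (r.1.readyUp = s.readyUp ∧ r.1.readyObj.dlvd = s.readyObj.dlvd ∧
        ∀ m id, e ≠ .readyDelivered p m id) ∨
      (∃ x, r.1.readyUp = x ::ₘ s.readyUp ∧ x ∉ s.readyObj.dlvd ∧
        r.1.readyObj.dlvd = insert x s.readyObj.dlvd ∧ ∀ m id, e ≠ .readyDelivered p m id) ∨
      ∃ m id, e = .readyDelivered p m id ∧ s.readyUp = (m, id) ::ₘ r.1.readyUp ∧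
        r.1.readyObj.dlvd = s.readyObj.dlvd := by
  cases h with
  | receive q msg =>
    cases msg with
    | ready m' id' =>
      simp only [LocalState.receive]
      have hd := fun x => KLState.mem_receive_dlvd (P := readyParams tb tm) (s := s.readyObj)
        (j := q) (m := m') (id := id') (x := x)
      cases ho : (s.readyObj.receive (readyParams tb tm) q m' id').2.2 with
      | none =>
        left
        refine ⟨rfl, Set.ext fun x => ?_, by simp⟩
        simpa [ho] using hd x
      | some y =>
        right; left
        obtain ⟨hy, -, hn⟩ := KLState.receive_deliver_eq_some ho
        refine ⟨y, rfl, by rw [hy]; exact hn m', Set.ext fun x => ?_, by simp⟩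
        simpa [ho, eq_comm, or_comm] using hd x
    | _ => simp [LocalState.receive]
  | readyDelivered m' id' s up h => exact Or.inr (Or.inr ⟨m', id', rfl, h, rfl⟩)
  | _ => simp [LocalState.castReady]

end

/-! ### The objects in an execution -/

/-- Every truncated subtraction in the counts is exact, so they pass to the reals. -/
theorem KLTrace.real_card_mul_le {n : ℕ} {A I : Type*} {P : KLParams} {tb tm : ℕ}
    {C : Finset (Fin n)} {σ : ℕ → Fin n → KLState n A I} {cast : ℕ → Fin n → A → I → Prop}
    {recv : ℕ → Fin n → Fin n → A → I → Prop} (h : KLTrace P tb tm C σ cast recv)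
    (htm : tm ≤ C.card) {m : A} {id : I}
    (hm : ∀ m', ∀ q ∈ C, ∀ t, (m', id) ∈ (σ t q).sent → m' = m) :
    ((senders C σ m id).card : ℝ) ≤ C.card ∧
    ((deliverers C σ m id).card : ℝ) ≤ (senders C σ m id).card ∧
    ((senders C σ m id).card : ℝ) * (C.card - tm) ≤
      (senders C σ m id).card * (senders C σ m id).card +
        (C.card - (senders C σ m id).card) * tb ∧
    ((senders C σ m id).card : ℝ) * (C.card - tm) ≤
      (deliverers C σ m id).card * (senders C σ m id).card +
        ((senders C σ m id).card - (deliverers C σ m id).card) * (P.qd - 1) +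
        (C.card - (senders C σ m id).card) * tb := by
  have h1 : (senders C σ m id).card ≤ C.card :=
    Finset.card_le_card fun p hp => (mem_senders.1 hp).1
  have h2 := Finset.card_le_card (h.deliverers_subset_senders hm)
  have h3 : 1 ≤ P.qd := lt_of_le_of_lt (Nat.zero_le _) h.lt_qd
  have h4 := h.card_mul_le hm
  have h5 := h.card_mul_le_deliverers hm
  refine ⟨by exact_mod_cast h1, by exact_mod_cast h2, ?_, ?_⟩
  · rw [← Nat.cast_sub h1, ← Nat.cast_sub htm]
    exact_mod_cast h4
  · rw [← Nat.cast_sub h1, ← Nat.cast_sub htm, ← Nat.cast_sub h2, ← Nat.cast_pred h3]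
    exact_mod_cast h5

variable {tb tm : ℕ} {C : Finset (Fin n)} {cfg : ℕ → Config n M}
  {ev : ℕ → Event n M}

namespace IsExecution

theorem echo_sent_mono (h : IsExecution tb tm C cfg ev) (t : ℕ) (p : Fin n) :
    ((cfg t).loc p).echoObj.sent ⊆ ((cfg (t + 1)).loc p).echoObj.sent := by
  rcases (h.step t).act p with ⟨-, e⟩ | ⟨-, r, ha, e, -⟩ <;> rw [e]
  rcases ha.echoObj with ⟨e, -⟩ | ⟨q, m, sn, -, e⟩ | ⟨q, m, id, -, e⟩ <;> rw [e]
  · exact fun x hx => KLState.mem_klCast_sent.2 (Or.inl hx)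
  · exact fun x hx => KLState.mem_receive_sent.2 (Or.inl hx)

theorem ready_sent_mono (h : IsExecution tb tm C cfg ev) (t : ℕ) (p : Fin n) :
    ((cfg t).loc p).readyObj.sent ⊆ ((cfg (t + 1)).loc p).readyObj.sent := by
  rcases (h.step t).act p with ⟨-, e⟩ | ⟨-, r, ha, e, -⟩ <;> rw [e]
  rcases ha.readyObj with ⟨e, -⟩ | ⟨m, id, -, e⟩ | ⟨q, m, id, -, e⟩ <;> rw [e]
  · exact fun x hx => KLState.mem_klCast_sent.2 (Or.inl hx)
  · exact fun x hx => KLState.mem_receive_sent.2 (Or.inl hx)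

theorem exists_broadcast_of_mem_net (h : IsExecution tb tm C cfg ev) {t : ℕ} {p q : Fin n}
    (hq : q ∈ C) {m : M} {sn : ℕ} (hx : (q, p, .init m sn) ∈ (cfg t).net) :
    ∃ t' < t, ev t' = .broadcast q m sn := by
  induction t with
  | zero => simp [h.start, Config.initial] at hx
  | succ t ih =>
    rcases (h.step t).mem_net hx hq with hx | ⟨r, ha, hr, -⟩
    · obtain ⟨t', ht, he⟩ := ih hx
      exact ⟨t', ht.trans t.lt_succ_self, he⟩
    · exact ⟨t, t.lt_succ_self, ha.eq_broadcast hr⟩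

theorem echo_sent_of_mem_net (h : IsExecution tb tm C cfg ev) {t : ℕ} {p q : Fin n}
    (hq : q ∈ C) {m : M} {id : AppId n} (hx : (q, p, .echo m id) ∈ (cfg t).net) :
    (m, id) ∈ ((cfg t).loc q).echoObj.sent := by
  induction t with
  | zero => simp [h.start, Config.initial] at hx
  | succ t ih =>
    rcases (h.step t).mem_net hx hq with hx | ⟨r, ha, hr, e⟩
    · exact h.echo_sent_mono t q (ih hx)
    · change (cfg (t + 1)).loc q = r.1 at e
      rw [e]
      exact ha.echo_mem_sent hr

theorem ready_sent_of_mem_net (h : IsExecution tb tm C cfg ev) {t : ℕ} {p q : Fin n}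
    (hq : q ∈ C) {m : M} {id : AppId n} (hx : (q, p, .ready m id) ∈ (cfg t).net) :
    (m, id) ∈ ((cfg t).loc q).readyObj.sent := by
  induction t with
  | zero => simp [h.start, Config.initial] at hx
  | succ t ih =>
    rcases (h.step t).mem_net hx hq with hx | ⟨r, ha, hr, e⟩
    · exact h.ready_sent_mono t q (ih hx)
    · change (cfg (t + 1)).loc q = r.1 at e
      rw [e]
      exact ha.ready_mem_sent hr

theorem mem_net_of_receive (h : IsExecution tb tm C cfg ev) {t : ℕ} {p q : Fin n}
    {msg : ImpMsg n M} (he : ev t = .receive p q msg) : (q, p, msg) ∈ (cfg t).net := by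
  have := h.step t
  rw [he] at this
  obtain ⟨-, net, e, -⟩ := this
  rw [e]
  exact Multiset.mem_cons_self _ _

/-- The history of the `echo` object. -/
theorem echoTrace (h : IsExecution tb tm C cfg ev) (hC : Cᶜ.card ≤ tb) (hn : tb ≤ n) :
    KLTrace (echoParams n tb) tb tm C (fun t p => ((cfg t).loc p).echoObj)
      (fun t p m id => ev t = .receive p id.2 (.init m id.1))
      (fun t p q m id => ev t = .receive p q (.echo m id)) where
  card_compl_le := hC
  single := rfl
  qf_eq := rfl
  lt_qd := by simp only [echoParams]; omega
  start p := by rw [h.start]; rfl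
  step t p _ := by
    rcases (h.step t).act p with ⟨-, e⟩ | ⟨-, r, ha, e, -⟩ <;> rw [e]
    · exact Or.inl rfl
    · rcases ha.echoObj with ⟨e, -⟩ | ⟨q, m, sn, h1, e⟩ | ⟨q, m, id, h1, e⟩
      · exact Or.inl e
      · exact Or.inr (Or.inl ⟨m, (sn, q), h1, e⟩)
      · exact Or.inr (Or.inr ⟨q, m, id, h1, e⟩)
  of_cast t p _ m id hc := by
    rcases (h.step t).act p with ⟨h1, -⟩ | ⟨-, r, ha, e, -⟩
    · simp [hc, Event.actor] at h1
    · rw [e]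
      rcases ha.echoObj with ⟨-, h1, -⟩ | ⟨q, m, sn, h1, e⟩ | ⟨q, m, id, h1, -⟩
      · exact absurd hc (h1 _ _ _)
      · rw [hc] at h1
        simp only [Event.receive.injEq, ImpMsg.init.injEq, true_and] at h1
        obtain ⟨rfl, rfl, rfl⟩ := h1
        exact e
      · simp [hc] at h1
  of_recv t p _ q m id hc := by
    rcases (h.step t).act p with ⟨h1, -⟩ | ⟨-, r, ha, e, -⟩
    · simp [hc, Event.actor] at h1
    · rw [e]
      rcases ha.echoObj with ⟨-, -, h1⟩ | ⟨q, m, sn, h1, e⟩ | ⟨q, m, id, h1, e⟩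
      · exact absurd hc (h1 _ _ _)
      · simp [hc] at h1
      · rw [hc] at h1
        simp only [Event.receive.injEq, ImpMsg.echo.injEq, true_and] at h1
        obtain ⟨rfl, rfl, rfl⟩ := h1
        exact e
  sent_of_recv t p _ q hq m id hc := h.echo_sent_of_mem_net hq (h.mem_net_of_receive hc)
  recv_of_sent t p hp m id h1 h2 := by
    rcases (h.step t).act p with ⟨-, e⟩ | ⟨-, r, ha, e, hD⟩
    · exact absurd (e ▸ h2) h1
    · rw [e] at h2
      obtain ⟨D, hD, hnet⟩ := hD _ (ha.eq_some_echo h1 h2)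
      refine ⟨D, hD, fun q hq hqD => ?_⟩
      obtain ⟨t', -, ht⟩ := h.received _ q hq p hp _ (hnet q hqD)
      exact ⟨t', ht⟩

/-- The history of the `ready` object. -/
theorem readyTrace (h : IsExecution tb tm C cfg ev) (hC : Cᶜ.card ≤ tb) :
    KLTrace (readyParams tb tm) tb tm C (fun t p => ((cfg t).loc p).readyObj)
      (fun t p m id => ev t = .echoDelivered p m id)
      (fun t p q m id => ev t = .receive p q (.ready m id)) where
  card_compl_le := hC
  single := rfl
  qf_eq := rfl
  lt_qd := by simp only [readyParams]; omega
  start p := by rw [h.start]; rfl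
  step t p _ := by
    rcases (h.step t).act p with ⟨-, e⟩ | ⟨-, r, ha, e, -⟩ <;> rw [e]
    · exact Or.inl rfl
    · rcases ha.readyObj with ⟨e, -⟩ | ⟨m, id, h1, e⟩ | ⟨q, m, id, h1, e⟩
      · exact Or.inl e
      · exact Or.inr (Or.inl ⟨m, id, h1, e⟩)
      · exact Or.inr (Or.inr ⟨q, m, id, h1, e⟩)
  of_cast t p _ m id hc := by
    rcases (h.step t).act p with ⟨h1, -⟩ | ⟨-, r, ha, e, -⟩
    · simp [hc, Event.actor] at h1
    · rw [e]
      rcases ha.readyObj with ⟨-, h1, -⟩ | ⟨m, id, h1, e⟩ | ⟨q, m, id, h1, -⟩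
      · exact absurd hc (h1 _ _)
      · rw [hc] at h1
        simp only [Event.echoDelivered.injEq, true_and] at h1
        obtain ⟨rfl, rfl⟩ := h1
        exact e
      · simp [hc] at h1
  of_recv t p _ q m id hc := by
    rcases (h.step t).act p with ⟨h1, -⟩ | ⟨-, r, ha, e, -⟩
    · simp [hc, Event.actor] at h1
    · rw [e]
      rcases ha.readyObj with ⟨-, -, h1⟩ | ⟨m, id, h1, e⟩ | ⟨q, m, id, h1, e⟩
      · exact absurd hc (h1 _ _ _)
      · simp [hc] at h1
      · rw [hc] at h1
        simp only [Event.receive.injEq, ImpMsg.ready.injEq, true_and] at h1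
        obtain ⟨rfl, rfl, rfl⟩ := h1
        exact e
  sent_of_recv t p _ q hq m id hc := h.ready_sent_of_mem_net hq (h.mem_net_of_receive hc)
  recv_of_sent t p hp m id h1 h2 := by
    rcases (h.step t).act p with ⟨-, e⟩ | ⟨-, r, ha, e, hD⟩
    · exact absurd (e ▸ h2) h1
    · rw [e] at h2
      obtain ⟨D, hD, hnet⟩ := hD _ (ha.eq_some_ready h1 h2)
      refine ⟨D, hD, fun q hq hqD => ?_⟩
      obtain ⟨t', -, ht⟩ := h.received _ q hq p hp _ (hnet q hqD)
      exact ⟨t', ht⟩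

theorem echo_dlvd_mono (h : IsExecution tb tm C cfg ev) (t : ℕ) (p : Fin n) :
    ((cfg t).loc p).echoObj.dlvd ⊆ ((cfg (t + 1)).loc p).echoObj.dlvd := by
  rcases (h.step t).act p with ⟨-, e⟩ | ⟨-, r, ha, e, -⟩ <;> rw [e]
  rcases ha.echoObj with ⟨e, -⟩ | ⟨q, m, sn, -, e⟩ | ⟨q, m, id, -, e⟩ <;> rw [e]
  · simp
  · exact fun x hx => KLState.mem_receive_dlvd.2 (Or.inl hx)

theorem echo_dlvd_of_mem_echoUp (h : IsExecution tb tm C cfg ev) {t : ℕ} {p : Fin n} {m : M}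
    {id : AppId n} (hu : (m, id) ∈ ((cfg t).loc p).echoUp) :
    (m, id) ∈ ((cfg t).loc p).echoObj.dlvd := by
  induction t with
  | zero => simp [h.start, Config.initial, LocalState.empty] at hu
  | succ t ih =>
    rcases (h.step t).act p with ⟨-, e⟩ | ⟨-, r, ha, e, -⟩
    · exact h.echo_dlvd_mono t p (ih (e ▸ hu))
    · rcases ha.mem_echoUp (e ▸ hu) with hu | hu
      · exact h.echo_dlvd_mono t p (ih hu)
      · rwa [e]

theorem echo_dlvd_of_echoDelivered (h : IsExecution tb tm C cfg ev) {t : ℕ} {p : Fin n} {m : M}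
    {id : AppId n} (he : ev t = .echoDelivered p m id) :
    (m, id) ∈ ((cfg t).loc p).echoObj.dlvd := by
  have := h.step t
  rw [he] at this
  obtain ⟨-, up, e, -⟩ := this
  exact h.echo_dlvd_of_mem_echoUp (by rw [e]; exact Multiset.mem_cons_self _ _)

theorem exists_echoDelivered (h : IsExecution tb tm C cfg ev) {t : ℕ} {p : Fin n} (hp : p ∈ C)
    {m : M} {id : AppId n} (hd : (m, id) ∈ ((cfg t).loc p).echoObj.dlvd) :
    ∃ t', ev t' = .echoDelivered p m id := by
  suffices ∃ t', (m, id) ∈ ((cfg t').loc p).echoUp by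
    obtain ⟨t', hu⟩ := this
    obtain ⟨t'', -, he⟩ := h.echoHandled t' p hp m id hu
    exact ⟨t'', he⟩
  induction t with
  | zero => simp [h.start, Config.initial, LocalState.empty, KLState.empty] at hd
  | succ t ih =>
    by_cases h0 : (m, id) ∈ ((cfg t).loc p).echoObj.dlvd
    · exact ih h0
    · rcases (h.step t).act p with ⟨-, e⟩ | ⟨-, r, ha, e, -⟩
      · exact absurd (e ▸ hd) h0
      · exact ⟨t + 1, e ▸ ha.mem_echoUp_of_dlvd h0 (e ▸ hd)⟩

/-- The four clauses must be proved together: a newly delivered pair is new to `dlvd`, hence neither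
pending nor already handled. The third clause yields no-duplication; the fourth turns a delivery by
the object into an mbrb-delivery. -/
theorem readyUp_spec (h : IsExecution tb tm C cfg ev) (t : ℕ) (p : Fin n) :
    ((cfg t).loc p).readyUp.Nodup ∧
      (∀ x ∈ ((cfg t).loc p).readyUp, x ∈ ((cfg t).loc p).readyObj.dlvd) ∧
      (∀ t' < t, ∀ m id, ev t' = .readyDelivered p m id →
        (m, id) ∈ ((cfg t).loc p).readyObj.dlvd ∧ (m, id) ∉ ((cfg t).loc p).readyUp) ∧
      ∀ m id, (m, id) ∈ ((cfg t).loc p).readyObj.dlvd →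
        (m, id) ∈ ((cfg t).loc p).readyUp ∨ ∃ t', ev t' = .readyDelivered p m id := by
  induction t with
  | zero => simp [h.start, Config.initial, LocalState.empty, KLState.empty]
  | succ t ih =>
    obtain ⟨i1, i2, i3, i4⟩ := ih
    rcases (h.step t).act p with ⟨h0, e⟩ | ⟨-, r, ha, e, -⟩ <;> rw [e]
    · refine ⟨i1, i2, fun t' ht m id he => ?_, i4⟩
      rcases Nat.lt_succ_iff_lt_or_eq.1 ht with ht | rfl
      · exact i3 t' ht m id he
      · simp [he, Event.actor] at h0
    · rcases ha.readyUp with ⟨e1, e2, h0⟩ | ⟨x, e1, hx, e2, h0⟩ | ⟨m, id, he, e1, e2⟩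
      · rw [e1, e2]
        refine ⟨i1, i2, fun t' ht m id he => ?_, i4⟩
        rcases Nat.lt_succ_iff_lt_or_eq.1 ht with ht | rfl
        · exact i3 t' ht m id he
        · exact absurd he (h0 _ _)
      · rw [e1, e2]
        refine ⟨Multiset.nodup_cons.2 ⟨fun hu => hx (i2 x hu), i1⟩, fun y hy => ?_,
          fun t' ht m id he => ?_, fun m id hd => ?_⟩
        · rcases Multiset.mem_cons.1 hy with rfl | hy
          · exact Set.mem_insert _ _
          · exact Set.mem_insert_of_mem _ (i2 y hy)
        · rcases Nat.lt_succ_iff_lt_or_eq.1 ht with ht | rfl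
          · obtain ⟨j1, j2⟩ := i3 t' ht m id he
            refine ⟨Set.mem_insert_of_mem _ j1, fun hu => ?_⟩
            rcases Multiset.mem_cons.1 hu with rfl | hu
            · exact hx j1
            · exact j2 hu
          · exact absurd he (h0 _ _)
        · rcases hd with rfl | hd
          · exact Or.inl (Multiset.mem_cons_self _ _)
          · exact (i4 m id hd).imp_left Multiset.mem_cons_of_mem
      · rw [e1] at i1 i2 i3 i4
        rw [e2]
        obtain ⟨hn, i1⟩ := Multiset.nodup_cons.1 i1
        refine ⟨i1, fun y hy => i2 y (Multiset.mem_cons_of_mem hy), fun t' ht m' id' he' => ?_,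
          fun m' id' hd => ?_⟩
        · rcases Nat.lt_succ_iff_lt_or_eq.1 ht with ht | rfl
          · obtain ⟨j1, j2⟩ := i3 t' ht m' id' he'
            exact ⟨j1, fun hu => j2 (Multiset.mem_cons_of_mem hu)⟩
          · rw [he] at he'
            simp only [Event.readyDelivered.injEq, true_and] at he'
            obtain ⟨rfl, rfl⟩ := he'
            exact ⟨i2 _ (Multiset.mem_cons_self _ _), hn⟩
        · rcases i4 m' id' hd with hu | hu
          · rcases Multiset.mem_cons.1 hu with hu | hu
            · simp only [Prod.mk.injEq] at hu
              obtain ⟨rfl, rfl⟩ := hu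
              exact Or.inr ⟨t, he⟩
            · exact Or.inl hu
          · exact Or.inr hu

theorem mem_readyUp_of_readyDelivered (h : IsExecution tb tm C cfg ev) {t : ℕ} {p : Fin n}
    {m : M} {id : AppId n} (he : ev t = .readyDelivered p m id) :
    (m, id) ∈ ((cfg t).loc p).readyUp := by
  have := h.step t
  rw [he] at this
  obtain ⟨-, up, e, -⟩ := this
  rw [e]
  exact Multiset.mem_cons_self _ _

theorem ready_dlvd_of_readyDelivered (h : IsExecution tb tm C cfg ev) {t : ℕ} {p : Fin n}
    {m : M} {id : AppId n} (he : ev t = .readyDelivered p m id) :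
    (m, id) ∈ ((cfg t).loc p).readyObj.dlvd :=
  (h.readyUp_spec t p).2.1 _ (h.mem_readyUp_of_readyDelivered he)

theorem exists_readyDelivered (h : IsExecution tb tm C cfg ev) {t : ℕ} {p : Fin n} (hp : p ∈ C)
    {m : M} {id : AppId n} (hd : (m, id) ∈ ((cfg t).loc p).readyObj.dlvd) :
    ∃ t', ev t' = .readyDelivered p m id := by
  rcases (h.readyUp_spec t p).2.2.2 m id hd with hu | hu
  · obtain ⟨t', -, he⟩ := h.readyHandled t p hp m id hu
    exact ⟨t', he⟩
  · exact hu

theorem readyDelivered_injective (h : IsExecution tb tm C cfg ev) {t t' : ℕ} {p : Fin n}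
    {m : M} {id : AppId n} (he : ev t = .readyDelivered p m id)
    (he' : ev t' = .readyDelivered p m id) : t = t' := by
  have key : ∀ u u', u < u' → ev u = .readyDelivered p m id →
      ev u' ≠ .readyDelivered p m id := fun u u' hu h1 h2 =>
    ((h.readyUp_spec u' p).2.2.1 u hu m id h1).2 (h.mem_readyUp_of_readyDelivered h2)
  rcases lt_trichotomy t t' with hlt | rfl | hlt
  · exact absurd he' (key _ _ hlt he)
  · rfl
  · exact absurd he (key _ _ hlt he')

theorem exists_broadcast_of_echo_sent (h : IsExecution tb tm C cfg ev) (hC : Cᶜ.card ≤ tb)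
    (hn : tb ≤ n) {t : ℕ} {p j : Fin n} (hp : p ∈ C) (hj : j ∈ C) {m : M} {sn : ℕ}
    (hs : (m, (sn, j)) ∈ ((cfg t).loc p).echoObj.sent) :
    ∃ t' < t, ev t' = .broadcast j m sn := by
  obtain ⟨q, -, t', ht, he⟩ := (h.echoTrace hC hn).exists_cast_of_sent hp hs
  obtain ⟨t'', ht', hb⟩ := h.exists_broadcast_of_mem_net hj (h.mem_net_of_receive he)
  exact ⟨t'', ht'.trans ht, hb⟩

theorem exists_echo_dlvd_of_ready_sent (h : IsExecution tb tm C cfg ev) (hC : Cᶜ.card ≤ tb)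
    {t : ℕ} {p : Fin n} (hp : p ∈ C) {m : M} {id : AppId n}
    (hs : (m, id) ∈ ((cfg t).loc p).readyObj.sent) :
    ∃ q ∈ C, ∃ t' < t, (m, id) ∈ ((cfg t').loc q).echoObj.dlvd := by
  obtain ⟨q, hq, t', ht, he⟩ := (h.readyTrace hC).exists_cast_of_sent hp hs
  exact ⟨q, hq, t', ht, h.echo_dlvd_of_echoDelivered he⟩

/-- Each `ready` message goes back to an echo delivery at a correct process, and echo quorums
intersect in a correct process. -/
theorem ready_sent_agree (h : IsExecution tb tm C cfg ev) (hC : Cᶜ.card ≤ tb) (hn : tb ≤ n)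
    {t t' : ℕ} {p p' : Fin n} (hp : p ∈ C) (hp' : p' ∈ C) {m m' : M} {id : AppId n}
    (hs : (m, id) ∈ ((cfg t).loc p).readyObj.sent)
    (hs' : (m', id) ∈ ((cfg t').loc p').readyObj.sent) : m = m' := by
  obtain ⟨q, hq, u, -, hd⟩ := h.exists_echo_dlvd_of_ready_sent hC hp hs
  obtain ⟨q', hq', u', -, hd'⟩ := h.exists_echo_dlvd_of_ready_sent hC hp' hs'
  exact (h.echoTrace hC hn).dlvd_agree (by simp only [echoParams]; omega) hq hq' hd hd'

theorem exists_ready_sent_of_readyDelivered (h : IsExecution tb tm C cfg ev) (hC : Cᶜ.card ≤ tb)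
    {t : ℕ} {p : Fin n} (hp : p ∈ C) {m : M} {id : AppId n}
    (he : ev t = .readyDelivered p m id) :
    ∃ q ∈ C, ∃ t' < t, (m, id) ∈ ((cfg t').loc q).readyObj.sent :=
  (h.readyTrace hC).exists_sent_of_dlvd hp (h.ready_dlvd_of_readyDelivered he)

theorem exists_broadcast_of_readyDelivered (h : IsExecution tb tm C cfg ev)
    (hC : Cᶜ.card ≤ tb) (hn : tb ≤ n) {t : ℕ} {p j : Fin n} (hp : p ∈ C) (hj : j ∈ C) {m : M}
    {sn : ℕ} (he : ev t = .readyDelivered p m (sn, j)) :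
    ∃ t' < t, ev t' = .broadcast j m sn := by
  obtain ⟨q, hq, t1, ht1, hs⟩ := h.exists_ready_sent_of_readyDelivered hC hp he
  obtain ⟨q', hq', t2, ht2, hd⟩ := h.exists_echo_dlvd_of_ready_sent hC hq hs
  obtain ⟨q'', hq'', t3, ht3, hs⟩ := (h.echoTrace hC hn).exists_sent_of_dlvd hq' hd
  obtain ⟨t4, ht4, hb⟩ := h.exists_broadcast_of_echo_sent hC hn hq'' hj hs
  exact ⟨t4, by omega, hb⟩

/-- At most `tm` copies of the `init` message are lost. Any other correct process casts on receiving
it, so it has sent some echo under this identity, necessarily of `m` by `hm`. -/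
theorem card_sub_le_echo_senders (h : IsExecution tb tm C cfg ev) (hC : Cᶜ.card ≤ tb)
    (hn : tb ≤ n) {t : ℕ} {i : Fin n} (hi : i ∈ C) {m : M} {sn : ℕ}
    (hm : ∀ m', ∀ q ∈ C, ∀ t, (m', (sn, i)) ∈ ((cfg t).loc q).echoObj.sent → m' = m)
    (hb : ev t = .broadcast i m sn) :
    C.card ≤
      (KLTrace.senders C (fun t p => ((cfg t).loc p).echoObj) m (sn, i)).card + tm := by
  have hst := h.step t
  rw [hb] at hst
  obtain ⟨D, hD, hnet⟩ := hst.2.spec.2.2.1 _ rfl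
  have hsub : C \ D ⊆ KLTrace.senders C (fun t p => ((cfg t).loc p).echoObj) m (sn, i) := by
    intro p hp
    obtain ⟨hp, hpD⟩ := Finset.mem_sdiff.1 hp
    obtain ⟨t', -, he⟩ := h.received _ p hp i hi _ (hnet p hpD)
    obtain ⟨m', hs⟩ := (h.echoTrace hC hn).exists_sent_of_cast (m := m) (id := (sn, i)) hp he
    obtain rfl := hm m' p hp _ hs
    exact KLTrace.mem_senders.2 ⟨hp, _, hs⟩
  have h1 := Finset.card_le_card hsub
  have h2 := Finset.le_card_sdiff D C
  omega

theorem echo_deliverers_subset_ready_senders (h : IsExecution tb tm C cfg ev)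
    (hC : Cᶜ.card ≤ tb) {m : M} {id : AppId n}
    (hm : ∀ m', ∀ q ∈ C, ∀ t, (m', id) ∈ ((cfg t).loc q).readyObj.sent → m' = m) :
    KLTrace.deliverers C (fun t p => ((cfg t).loc p).echoObj) m id ⊆
      KLTrace.senders C (fun t p => ((cfg t).loc p).readyObj) m id := by
  intro p hpD
  obtain ⟨hp, t, hd⟩ := KLTrace.mem_deliverers.1 hpD
  obtain ⟨t', he⟩ := h.exists_echoDelivered hp hd
  obtain ⟨m', hs⟩ := (h.readyTrace hC).exists_sent_of_cast hp he
  obtain rfl := hm m' p hp _ hs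
  exact KLTrace.mem_senders.2 ⟨hp, _, hs⟩

end IsExecution

end MBRB

/-! ### The MBRB properties. -/

theorem theorem3 {M : Type*} (n tb tm : ℕ)
    (hn : (n : ℝ) > 3 * tb + 2 * tm + 2 * √((tb : ℝ) * tm))
    (C : Finset (Fin n)) (hC : Cᶜ.card ≤ tb)
    (cfg : ℕ → MBRB.Config n M) (ev : ℕ → MBRB.Event n M)
    (hexec : MBRB.IsExecution tb tm C cfg ev)
    (hsn : MBRB.DistinctSeqNumbers C (MBRB.Broadcasts ev)) :
    MBRB.IsMBRB C (MBRB.Broadcasts ev) (MBRB.Delivers ev)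
      ⌈(C.card : ℝ) * (1 - (tm : ℝ) / ((C.card : ℝ) - 2 * tb - tm))⌉ := by
  have hb : (0 : ℝ) ≤ tb := Nat.cast_nonneg _
  have ha : (0 : ℝ) ≤ tm := Nat.cast_nonneg _
  have hs : 0 ≤ √((tb : ℝ) * tm) := Real.sqrt_nonneg _
  have hss : √((tb : ℝ) * tm) * √((tb : ℝ) * tm) = tb * tm :=
    Real.mul_self_sqrt (mul_nonneg hb ha)
  set s := √((tb : ℝ) * tm)
  have hcn : C.card + Cᶜ.card = n := by simp
  have hcn' : C.card ≤ n := by omega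
  have hnc : n ≤ C.card + tb := by omega
  have hcnR : (C.card : ℝ) ≤ n := by exact_mod_cast hcn'
  have hncR : (n : ℝ) ≤ C.card + tb := by exact_mod_cast hnc
  have hc : 2 * (tb : ℝ) + 2 * tm + 2 * s < C.card := by linarith
  have hc1 : 2 * tb + 2 * tm + 1 ≤ C.card := by
    have : 2 * (tb : ℝ) + 2 * tm < C.card := by linarith
    exact_mod_cast this
  have hc1R : 2 * (tb : ℝ) + 2 * tm + 1 ≤ C.card := by exact_mod_cast hc1
  have htn : tb ≤ n := by omega
  have htm : tm ≤ C.card := by omega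
  have hb1 : (tb : ℝ) = 0 ∨ 1 ≤ (tb : ℝ) := by
    rcases Nat.eq_zero_or_pos tb with h | h
    · exact Or.inl (by exact_mod_cast h)
    · exact Or.inr (by exact_mod_cast h)
  have hE := hexec.echoTrace hC htn
  have hR := hexec.readyTrace hC
  refine ⟨?_, ?_, ?_, ?_, ?_⟩
  · intro i hi j hj t m sn hd
    exact hexec.exists_broadcast_of_readyDelivered hC htn hi hj hd
  · intro i hi j t t' m m' sn hd hd'
    have hm : m = m' := hR.dlvd_unique hi (hexec.ready_dlvd_of_readyDelivered hd)
      (hexec.ready_dlvd_of_readyDelivered hd')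
    subst hm
    exact ⟨hexec.readyDelivered_injective hd hd', rfl⟩
  · intro i hi i' hi' j t t' m m' sn hd hd'
    obtain ⟨q, hq, u, -, h1⟩ := hexec.exists_ready_sent_of_readyDelivered hC hi hd
    obtain ⟨q', hq', u', -, h2⟩ := hexec.exists_ready_sent_of_readyDelivered hC hi' hd'
    exact hexec.ready_sent_agree hC htn hq hq' h1 h2
  · intro i hi t m sn hbc
    have hmE : ∀ m', ∀ q ∈ C, ∀ t, (m', (sn, i)) ∈ ((cfg t).loc q).echoObj.sent → m' = m := by
      intro m' q hq u hs
      obtain ⟨t', -, hb'⟩ := hexec.exists_broadcast_of_echo_sent hC htn hq hi hs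
      -- Every echo under `(sn, i)` comes from a broadcast by `i` with number `sn`; distinct
      -- sequence numbers leave only the broadcast at time `t`.
      obtain rfl := hsn i hi t' t m' m sn hb' hbc
      have := hb'.symm.trans hbc
      simpa using this
    have hmR : ∀ m', ∀ q ∈ C, ∀ t, (m', (sn, i)) ∈ ((cfg t).loc q).readyObj.sent → m' = m := by
      intro m' q hq u hs
      obtain ⟨q', hq', u', -, hd⟩ := hexec.exists_echo_dlvd_of_ready_sent hC hq hs
      obtain ⟨q'', hq'', u'', -, hs'⟩ := hE.exists_sent_of_dlvd hq' hd
      exact hmE m' q'' hq'' u'' hs'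
    obtain ⟨e1, e2, -, e4⟩ := hE.real_card_mul_le htm hmE
    obtain ⟨r1, r2, -, r4⟩ := hR.real_card_mul_le htm hmR
    have hk : (C.card : ℝ) ≤ _ :=
      Nat.cast_le.2 (hexec.card_sub_le_echo_senders hC htn hi hmE hbc)
    have hsub : ((_ : ℕ) : ℝ) ≤ _ :=
      Nat.cast_le.2 (Finset.card_le_card (hexec.echo_deliverers_subset_ready_senders hC hmR))
    push_cast at hk
    have hqd : (((MBRB.echoParams n tb).qd : ℝ) - 1) = (((n + tb) / 2 : ℕ) : ℝ) := by
      simp [MBRB.echoParams]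
    rw [hqd] at e4
    -- These two bounds replace `n` by `c`: the upper one uses `n ≤ c + tb`, the lower one `c ≤ n`
    -- and a rounding loss of at most one half.
    have hq1 : (((n + tb) / 2 : ℕ) : ℝ) ≤ (C.card + 2 * tb) / 2 := by
      have : 2 * ((n + tb) / 2) ≤ C.card + 2 * tb := by omega
      have : 2 * (((n + tb) / 2 : ℕ) : ℝ) ≤ C.card + 2 * tb := by exact_mod_cast this
      linarith
    have hq2 : ((C.card : ℝ) + tb - 1) / 2 ≤ (((n + tb) / 2 : ℕ) : ℝ) := by
      have : C.card + tb ≤ 2 * ((n + tb) / 2) + 1 := by omega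
      have : (C.card : ℝ) + tb ≤ 2 * (((n + tb) / 2 : ℕ) : ℝ) + 1 := by exact_mod_cast this
      linarith
    have hcc : 4 * ((tb : ℝ) * tm) + 1 ≤ C.card * (C.card - 2 * tb - 2 * tm) := by
      have h1 : 4 * ((tb : ℝ) * tm) < C.card * (C.card - 2 * tb - 2 * tm) := by
        nlinarith [mul_lt_mul'' (by linarith : 2 * s < C.card)
          (by linarith : 2 * s < (C.card : ℝ) - 2 * tb - 2 * tm) (by linarith) (by linarith)]
      -- Both sides are integers, so the strict inequality gains the unit required by `echo_quorum`.
      have h2 : 4 * ((tb : ℤ) * tm) < C.card * (C.card - 2 * tb - 2 * tm) := by exact_mod_cast h1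
      have h3 : 4 * ((tb : ℤ) * tm) + 1 ≤ C.card * (C.card - 2 * tb - 2 * tm) := h2
      exact_mod_cast h3
    have hEl := MBRB.mul_le_mul_of_quorum (by linarith) e1
      (MBRB.echo_quorum hb ha hcc hq1 hq2) e4
    obtain ⟨p, hp⟩ : (MBRB.KLTrace.deliverers C (fun t p => ((cfg t).loc p).readyObj) m
        (sn, i)).Nonempty := by
      by_contra hne
      rw [Finset.not_nonempty_iff_eq_empty] at hne
      rw [hne] at r4
      refine MBRB.ready_trigger hb ha hs hss hc hq1 hEl hsub ?_
      simpa [MBRB.readyParams] using r4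
    obtain ⟨hp, u, hd⟩ := MBRB.KLTrace.mem_deliverers.1 hp
    obtain ⟨t', he⟩ := hexec.exists_readyDelivered hp hd
    obtain ⟨t'', ht, hb'⟩ := hexec.exists_broadcast_of_readyDelivered hC htn hp hi he
    -- Validity supplies a broadcast before the delivery; uniqueness of sequence numbers identifies
    -- it with the given one, so the delivery comes after time `t`.
    obtain rfl := hsn i hi t'' t m m sn hb' hbc
    exact ⟨p, hp, t', ht, he⟩
  · intro i hi j t m sn hd
    obtain ⟨q0, hq0, u0, -, hs0⟩ := hexec.exists_ready_sent_of_readyDelivered hC hi hd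
    have hmR : ∀ m', ∀ q ∈ C, ∀ t, (m', (sn, j)) ∈ ((cfg t).loc q).readyObj.sent → m' = m :=
      fun m' q hq u hs => hexec.ready_sent_agree hC htn hq hq0 hs hs0
    obtain ⟨r1, r2, r3, r4⟩ := hR.real_card_mul_le htm hmR
    have hqd : (((MBRB.readyParams tb tm).qd : ℝ) - 1) = 2 * tb + tm := by
      simp [MBRB.readyParams]
    rw [hqd] at r4
    -- Of the `2 tb + tm + 1` sources behind this delivery, at most `tb` are Byzantine, which leaves
    -- `tb + tm + 1` correct senders.
    have hk := hR.qd_le_card_senders_add hi (hexec.ready_dlvd_of_readyDelivered hd)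
    have hk' : (tb : ℝ) + tm + 1 ≤
        (MBRB.KLTrace.senders C (fun t p => ((cfg t).loc p).readyObj) m (sn, j)).card := by
      simp only [MBRB.readyParams] at hk
      exact_mod_cast (by omega : tb + tm + 1 ≤ _)
    have hl := MBRB.mul_le_mul_of_quorum
      (MBRB.ready_lt_card hb ha hs hss hc hk' hb1 hc1R r3) r1
      (MBRB.ready_quorum hb ha hs hss hc) r4
    have hset : {p : Fin n | p ∈ C ∧ ∃ t', MBRB.Delivers ev t' p m sn j} =
        MBRB.KLTrace.deliverers C (fun t p => ((cfg t).loc p).readyObj) m (sn, j) := by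
      ext p
      simp only [Set.mem_ofPred_eq, Finset.mem_coe, MBRB.KLTrace.mem_deliverers]
      refine and_congr_right fun hp => ⟨?_, ?_⟩
      · rintro ⟨t', he⟩
        exact ⟨t', hexec.ready_dlvd_of_readyDelivered he⟩
      · rintro ⟨t', hd⟩
        exact hexec.exists_readyDelivered hp hd
    rw [hset, Set.ncard_coe_finset, Int.ceil_le]
    have hpos : 0 < (C.card : ℝ) - 2 * tb - tm := by linarith
    have heq : (C.card : ℝ) * (1 - tm / (C.card - 2 * tb - tm)) =
        C.card * (C.card - (2 * tb + tm) - tm) / (C.card - 2 * tb - tm) := by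
      field_simp
      ring
    rw [heq, div_le_iff₀ hpos]
    push_cast
    linarith
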